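/- **Theorem (spectrum theorem).** Let $N\ge 1$, let $C(\mu)=\mu^{2N+1}+0\cdot\mu^{2N}+c_2\mu^{2N-1}+\cdots+c_{2N+1}$ be a real polynomial, and let $w_1,\dots,w_N:\mathbb R\to\mathbb R$ be $C^2$ functions such that $w(x;\mu)=\mu^N+w_1(x)\mu^{N-1}+\cdots+w_N(x)$ satisfies, identically in $\mu$ and $x$, $$C(\mu)=w_{xx}w-\tfrac12 w_x^2+(\mu-2w_1)\,w^2 ,$$ so that $u=2w_1$ is a stationary (finite-gap) solution of the KdV equation $u_t=-\tfrac12u_{xxx}+\tfrac32uu_x$. Suppose that $w$ comes from a solution of the Neumann system: there are real numbers $a_1<\dots<a_{N+1}$ and a motion $X(t)$, $t\in\mathbb R$, of a particle on the unit sphere $S^N\subset\mathbb R^{N+1}$ with Hamiltonian $\tfrac12|P|^2+\sum_i a_iX_i^2$ (that is, $\ddot X_i+2a_iX_i=\nu(t) X_i$ for all $i$, with a scalar function $\nu$) such that, for all $x$ and $i$, $$X_i(x/2)^2=\frac{w(x;a_i)}{\prod_{j\ne i}(a_i-a_j)},$$ i.e. the zeros of $w(x;\cdot)$ are the sphero-ellipsoidal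 coordinates of the point $X(x/2)$. We say that $E\in\mathbb R$ lies in the spectrum of $-\partial_x^2+\tfrac12u$ if there is a bounded, not identically zero $C^2$ function $\psi:\mathbb R\to\mathbb R$ with $-\psi''+\tfrac12u\psi=E\psi$. Call $\lambda\in\mathbb R$ degenerate if $w(x;\lambda)=0$ for all $x\in\mathbb R$ and $C(\mu)<0$ for all $\mu\neq\lambda$ sufficiently close to $\lambda$. Then all roots of $C$ are real. Denote them, with multiplicities, by $r_1\le r_2\le\dots\le r_{2N+1}$. Then $$[r_1,r_2]\cup[r_3,r_4]\cup\dots\cup[r_{2N-1},r_{2N}]\cup[r_{2N+1},\infty)=\{\lambda\in\mathbb R: C(\lambda)\ge0\},$$ and for every non-degenerate $\lambda\in\mathbb R$, $\tfrac12\lambda$ lies in the spectrum of $-\partial_x^2+\tfrac12u$ if and only if $\lambda$ belongs to this set. In particular, if there is no degenerate $\lambda$, then $\{\lambda:\tfrac12\lambda\text{ lies in the spectrum}\}=\{\lambda:C(\lambda)\ge0\}$: finitely many (at most $N$) bands, possibly reduced to points, plus one infinite band. -/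

import Mathlib

open Polynomial Filter Topology Set

noncomputable section

/-- The value `w(x; μ) = μ^N + μ^(N-1) w₁(x) + ⋯ + w_N(x)`. The functions `w₁, …, w_N` are
`w 0, …, w (N-1)`. -/
def wVal {N : ℕ} (w : Fin N → ℝ → ℝ) (μ x : ℝ) : ℝ :=
  μ ^ N + ∑ j : Fin N, w j x * μ ^ (N - 1 - (j : ℕ))

/-- The curve `u = 2 w₁`. -/
def kdvPotential {N : ℕ} [NeZero N] (w : Fin N → ℝ → ℝ) (x : ℝ) : ℝ := 2 * w 0 x

/-- `(w₁, …, w_N)` is a solution, defined on all of `ℝ`, of the finite-dimensional (stationary)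
reduction of KdV `u_t = -½ u_xxx + (3/2) u u_x` with polynomial `P = C`: the polynomial `P` is monic
of degree `2N+1` with vanishing second highest coefficient, and
`P(μ) = w_xx w - ½ w_x² + (μ - 2 w₁) w²` identically in `μ` and `x`. -/
structure IsReducedKdVSolution {N : ℕ} [NeZero N] (P : ℝ[X]) (w : Fin N → ℝ → ℝ) : Prop where
  monic : P.Monic
  natDegree_eq : P.natDegree = 2 * N + 1
  coeff_eq_zero : P.coeff (2 * N) = 0
  contDiff : ∀ j, ContDiff ℝ 2 (w j)
  equation : ∀ μ x : ℝ,
    P.eval μ = deriv (deriv (wVal w μ)) x * wVal w μ x - (1 / 2) * (deriv (wVal w μ) x) ^ 2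
      + (μ - kdvPotential w x) * wVal w μ x ^ 2

/-- `X = (X₁, …, X_{N+1})` is a motion of the Neumann system with parameters `a`: a particle on the
unit sphere `S^N ⊂ ℝ^{N+1}` with Hamiltonian `½ |P|² + V`, `V = ∑ aᵢ Xᵢ²`; that is, `X'' + grad V`
is normal to the sphere. -/
structure IsNeumannSolution {N : ℕ} (a : Fin (N + 1) → ℝ) (X : Fin (N + 1) → ℝ → ℝ) : Prop where
  contDiff : ∀ i, ContDiff ℝ 2 (X i)
  mem_sphere : ∀ t, ∑ i, X i t ^ 2 = 1
  equation : ∀ t, ∃ ν : ℝ, ∀ i, deriv (deriv (X i)) t + 2 * a i * X i t = ν * X i t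

/-- `w` comes from a solution of a Neumann system with distinct parameters `a₁ < ⋯ < a_{N+1}`: up to
the time change `t = x / 2`, the zeros `q₁, …, q_N` of `w(x; ·)` are the sphero-ellipsoidal
coordinates of the moving point, `Xᵢ² = ∏ⱼ (aᵢ - qⱼ) / ∏_{j ≠ i} (aᵢ - aⱼ)`, where
`∏ⱼ (aᵢ - qⱼ) = w(x; aᵢ)`. An additive constant in the potential only translates all `aᵢ`, so
the `aᵢ` are arbitrary distinct reals. -/
def ComesFromNeumann {N : ℕ} (w : Fin N → ℝ → ℝ) : Prop :=
  ∃ (a : Fin (N + 1) → ℝ) (X : Fin (N + 1) → ℝ → ℝ),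
    StrictMono a ∧ IsNeumannSolution a X ∧
      ∀ (x : ℝ) (i : Fin (N + 1)),
        X i (x / 2) ^ 2 = wVal w (a i) x / ∏ j ∈ Finset.univ.erase i, (a i - a j)

/-- `E` lies in the spectrum of `-∂ₓ² + ½ u`: there is a bounded nonzero solution `ψ`, on all of
`ℝ`, of `-ψ'' + ½ u ψ = E ψ`. -/
def InSpectrum (u : ℝ → ℝ) (E : ℝ) : Prop :=
  ∃ ψ : ℝ → ℝ, ContDiff ℝ 2 ψ ∧ (∃ x, ψ x ≠ 0) ∧ (∃ M, ∀ x, |ψ x| ≤ M) ∧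
    ∀ x, -deriv (deriv ψ) x + (1 / 2) * u x * ψ x = E * ψ x

/-- The set `[r₁, r₂] ∪ [r₃, r₄] ∪ ⋯ ∪ [r_{2N-1}, r_{2N}] ∪ [r_{2N+1}, ∞)`; the numbers
`r₁, …, r_{2N+1}` are `r 0, …, r (2N)`. -/
def bands {N : ℕ} (r : Fin (2 * N + 1) → ℝ) : Set ℝ :=
  (⋃ i : Fin N, Icc (r ⟨2 * i, by omega⟩) (r ⟨2 * i + 1, by omega⟩)) ∪ Ici (r (Fin.last (2 * N)))

/-- The degenerate values: `w(x; lam) = 0` for all `x` (so that `P lam = 0`), and `lam` is an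
isolated point of `{P ≥ 0}`. -/
def IsDegenerateValue {N : ℕ} (P : ℝ[X]) (w : Fin N → ℝ → ℝ) (lam : ℝ) : Prop :=
  (∀ x, wVal w lam x = 0) ∧ ∀ᶠ μ in 𝓝[≠] lam, P.eval μ < 0

end

/-! Put s = (u - λ)/2. The equation defining C says that C(λ) is a first integral, along f = w(·;
λ), of the linear equation f''' = 4sf' + 2s'f, whose solution space is spanned by products of two
solutions of ψ'' = sψ. The Neumann system supplies boundedness: w(x; μ) = ∑ᵢ ρᵢ ∏_{j≠i} (μ - aⱼ)
with ρ in the standard simplex, so the wⱼ are bounded, and the equation then bounds their first two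
derivatives (`regularity`).

Reality of the roots (`im_eq_zero_of_bounded_complex_solution`): at a nonreal root z write w(x; z) =
φ², so φ'' = ½(u - z)φ. The bounded quantity Im(φ̄φ') has derivative -½ Im(z) |φ|², while |φ| stays
away from 0, which is impossible.

C(λ) < 0 (`eq_zero_of_bounded_of_neg`): Tψ = wψ' - ½w'ψ maps solutions of ψ'' = sψ to solutions, and
T² = -C(λ)/2 > 0. For bounded ψ the nonpositive function -¼((Tψ)² - ½C(λ)ψ²) is the derivative of a
bounded p built from w and ∂w/∂μ. So p is monotone with limits at ±∞; these limits turn out to be 0,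
whence p = 0 and ψ = 0.

C(λ) ≥ 0 (`inSpectrum_of_nonneg`, `exists_bounded_solution_of_nonneg`): let f be the first Taylor
coefficient of w at λ that is not identically zero in x, of order m, and C(λ + t) = t^(2m) R(t).
Then f solves the third order equation with first integral R(0). If R(0) ≥ 0, ±f is a sum of two
squares of solutions, which are therefore bounded. If R(0) < 0, then m > 0 and C < 0 on a punctured
neighbourhood of λ: the degenerate case. -/

/-! ### Linear differential equations on the whole line. -/

/-- Global solvability of linear differential equations with bounded coefficients. -/
theorem exists_forall_hasDerivAt_linear {E : Type*} [NormedAddCommGroup E] [NormedSpace ℝ E]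
    [CompleteSpace E] (A : ℝ → E →L[ℝ] E) (hA : Continuous A) (K : ℝ) (hK : ∀ t, ‖A t‖ ≤ K)
    (v₀ : E) : ∃ v : ℝ → E, v 0 = v₀ ∧ ∀ t, HasDerivAt v (A t (v t)) t := by
  have hK0 : 0 ≤ K := (norm_nonneg _).trans (hK 0)
  -- Solutions grow at most like exp(K|x|). Dividing by cosh(Mx), a smooth substitute for exp(M|x|)
  -- with M > K, makes the Picard map a contraction on all of ℝ with ratio K/M.
  set M : ℝ := K + 1 with hM
  have hM0 : 0 < M := by positivity
  have hc : ∀ x : ℝ, 0 < Real.cosh (M * x) := fun x => Real.cosh_pos _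
  have hcc : Continuous fun x : ℝ => Real.cosh (M * x) := by fun_prop
  have hint : ∀ x : ℝ, |∫ t in (0 : ℝ)..x, Real.cosh (M * t)| ≤ Real.cosh (M * x) / M := by
    intro x
    have h1 : ∀ t ∈ Set.uIcc 0 x,
        HasDerivAt (fun t : ℝ => Real.sinh (M * t) / M) (Real.cosh (M * t)) t := by
      intro t _
      have := (((hasDerivAt_id t).const_mul M).sinh).div_const M
      simpa [hM0.ne'] using this
    rw [intervalIntegral.integral_eq_sub_of_hasDerivAt h1 (hcc.intervalIntegrable _ _)]
    simp only [mul_zero, Real.sinh_zero, zero_div, sub_zero, abs_div, abs_of_pos hM0]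
    gcongr
    rw [abs_le]
    have e1 := Real.cosh_add_sinh (M * x)
    have e2 := Real.cosh_sub_sinh (M * x)
    have := Real.exp_pos (M * x)
    have := Real.exp_pos (-(M * x))
    constructor <;> linarith
  have hbd : ∀ (z : ℝ → E) (C : ℝ), (∀ t, ‖z t‖ ≤ C) → ∀ x,
      ‖∫ t in (0 : ℝ)..x, Real.cosh (M * t) • A t (z t)‖ ≤ K * C * (Real.cosh (M * x) / M) := by
    intro z C hz x
    have hC0 : 0 ≤ C := (norm_nonneg _).trans (hz 0)
    have := intervalIntegral.norm_integral_le_abs_of_norm_le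
      (f := fun t => Real.cosh (M * t) • A t (z t)) (a := 0) (b := x)
      (g := fun t => K * C * Real.cosh (M * t)) (μ := MeasureTheory.volume)
      (Eventually.of_forall fun t => by
        rw [norm_smul, Real.norm_of_nonneg (hc t).le, mul_comm]
        gcongr
        exact ((A t).le_opNorm _).trans (mul_le_mul (hK t) (hz t) (norm_nonneg _) hK0))
      ((continuous_const.mul hcc).intervalIntegrable _ _)
    rw [intervalIntegral.integral_const_mul, abs_mul, abs_of_nonneg (mul_nonneg hK0 hC0)] at this
    exact this.trans (mul_le_mul_of_nonneg_left (hint x) (mul_nonneg hK0 hC0))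
  have hcont : ∀ y : ℝ → E, Continuous y → Continuous fun t => Real.cosh (M * t) • A t (y t) :=
    fun y hy => hcc.smul (hA.clm_apply hy)
  have hone : ∀ x : ℝ, (Real.cosh (M * x))⁻¹ ≤ 1 := fun x => inv_le_one_of_one_le₀ (Real.one_le_cosh _)
  -- The unknown is y = v / cosh(M·), so that v solves the integral equation exactly when y is a
  -- fixed point.
  let F : BoundedContinuousFunction ℝ E → BoundedContinuousFunction ℝ E := fun y =>
    BoundedContinuousFunction.ofNormedAddCommGroup
      (fun x => (Real.cosh (M * x))⁻¹ • (v₀ + ∫ t in (0 : ℝ)..x, Real.cosh (M * t) • A t (y t)))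
      ((hcc.inv₀ fun x => (hc x).ne').smul (continuous_const.add
        (intervalIntegral.continuous_primitive
          (fun a b => (hcont y y.continuous).intervalIntegrable a b) 0)))
      (‖v₀‖ + K * ‖y‖ / M) (by
        intro x
        have h := hbd y ‖y‖ (fun t => y.norm_coe_le_norm t) x
        rw [norm_smul, Real.norm_of_nonneg (inv_nonneg.2 (hc x).le)]
        calc _ ≤ (Real.cosh (M * x))⁻¹ * (‖v₀‖ + K * ‖y‖ * (Real.cosh (M * x) / M)) := by
              have := inv_nonneg.2 (hc x).le
              gcongr
              exact (norm_add_le _ _).trans (by gcongr)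
          _ = (Real.cosh (M * x))⁻¹ * ‖v₀‖ + K * ‖y‖ / M := by
              field_simp [(hc x).ne']
          _ ≤ _ := by
              gcongr
              exact mul_le_of_le_one_left (norm_nonneg _) (hone x))
  have hF : ContractingWith (⟨K / M, by positivity⟩ : NNReal) F := by
    refine ⟨?_, LipschitzWith.of_dist_le_mul fun y z => ?_⟩
    · change K / M < 1
      rw [div_lt_one hM0]; linarith
    · change _ ≤ K / M * _
      rw [BoundedContinuousFunction.dist_le (by positivity)]
      intro x
      change dist ((Real.cosh (M * x))⁻¹ • (v₀ + ∫ t in (0 : ℝ)..x, Real.cosh (M * t) • A t (y t)))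
        ((Real.cosh (M * x))⁻¹ • (v₀ + ∫ t in (0 : ℝ)..x, Real.cosh (M * t) • A t (z t))) ≤ _
      rw [dist_eq_norm, ← smul_sub, add_sub_add_left_eq_sub,
        ← intervalIntegral.integral_sub ((hcont y y.continuous).intervalIntegrable _ _)
          ((hcont z z.continuous).intervalIntegrable _ _)]
      have h := hbd (fun t => y t - z t) (dist y z)
        (fun t => by rw [← dist_eq_norm]; exact BoundedContinuousFunction.dist_coe_le_dist t) x
      simp only [map_sub, smul_sub] at h
      rw [norm_smul, Real.norm_of_nonneg (inv_nonneg.2 (hc x).le)]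
      calc _ ≤ (Real.cosh (M * x))⁻¹ * (K * dist y z * (Real.cosh (M * x) / M)) :=
            mul_le_mul_of_nonneg_left h (inv_nonneg.2 (hc x).le)
        _ = _ := by field_simp [(hc x).ne']
  obtain ⟨y, hy, -⟩ := hF.exists_fixedPoint 0 (edist_ne_top _ _)
  have hy' : ∀ x, Real.cosh (M * x) • y x =
      v₀ + ∫ t in (0 : ℝ)..x, Real.cosh (M * t) • A t (y t) := by
    intro x
    have : y x = (Real.cosh (M * x))⁻¹ •
        (v₀ + ∫ t in (0 : ℝ)..x, Real.cosh (M * t) • A t (y t)) := by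
      conv_lhs => rw [← hy]
      rfl
    conv_lhs => rw [this]
    rw [smul_inv_smul₀ (hc x).ne']
  refine ⟨fun x => Real.cosh (M * x) • y x, by simpa using hy' 0, fun t => ?_⟩
  simp only [hy', map_add]
  rw [← map_add, ← hy', map_smul]
  exact ((hcont y y.continuous).integral_hasStrictDerivAt 0 t).hasDerivAt.const_add v₀

/-- Global solvability of `Φ'' = s Φ` for bounded continuous `s`. -/
theorem exists_hill_solution (s : ℝ → ℝ) (hs : Continuous s) (S : ℝ) (hS : ∀ x, |s x| ≤ S)
    (x₀ a b : ℝ) : ∃ Φ Φ' : ℝ → ℝ, Φ x₀ = a ∧ Φ' x₀ = b ∧ (∀ x, HasDerivAt Φ (Φ' x) x) ∧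
      ∀ x, HasDerivAt Φ' (s x * Φ x) x := by
  let A : ℝ → ℝ × ℝ →L[ℝ] ℝ × ℝ := fun t =>
    (ContinuousLinearMap.inl ℝ ℝ ℝ).comp (ContinuousLinearMap.snd ℝ ℝ ℝ) +
      s (t + x₀) • (ContinuousLinearMap.inr ℝ ℝ ℝ).comp (ContinuousLinearMap.fst ℝ ℝ ℝ)
  have hA : Continuous A := by fun_prop
  have hAy : ∀ t y, A t y = (y.2, s (t + x₀) * y.1) := fun t y => by simp [A]
  have hK : ∀ t, ‖A t‖ ≤ 1 + S := by
    intro t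
    have hS0 : 0 ≤ S := (abs_nonneg _).trans (hS 0)
    refine ContinuousLinearMap.opNorm_le_bound _ (by positivity) fun y => ?_
    rw [hAy, Prod.norm_def]
    refine max_le ?_ ?_
    · calc ‖y.2‖ ≤ 1 * ‖y‖ := by rw [one_mul]; exact norm_snd_le y
        _ ≤ _ := by gcongr; linarith
    · change ‖s (t + x₀) * y.1‖ ≤ _
      rw [norm_mul]
      calc _ ≤ S * ‖y‖ := mul_le_mul (hS _) (norm_fst_le y) (norm_nonneg _) hS0
        _ ≤ _ := by gcongr; linarith
  obtain ⟨v, hv0, hv⟩ := exists_forall_hasDerivAt_linear A hA _ hK (a, b)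
  have hv' : ∀ x, HasDerivAt (fun x => v (x - x₀)) (A (x - x₀) (v (x - x₀))) x := fun x => by
    simpa using (hv (x - x₀)).comp_sub_const x x₀
  refine ⟨fun x => (v (x - x₀)).1, fun x => (v (x - x₀)).2, by simp [hv0], by simp [hv0],
    fun x => ?_, fun x => ?_⟩
  · have := (ContinuousLinearMap.fst ℝ ℝ ℝ).hasFDerivAt.comp_hasDerivAt x (hv' x)
    rw [hAy] at this
    exact this
  · have := (ContinuousLinearMap.snd ℝ ℝ ℝ).hasFDerivAt.comp_hasDerivAt x (hv' x)
    rw [hAy, sub_add_cancel] at this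
    exact this

/-- Uniqueness for the equation `f''' = 4 s f' + 2 s' f` satisfied by products of solutions of
`Φ'' = s Φ`. -/
theorem eq_zero_of_third_order (s s' : ℝ → ℝ) (S S' : ℝ) (hS : ∀ x, |s x| ≤ S)
    (hS' : ∀ x, |s' x| ≤ S') (f f₁ f₂ : ℝ → ℝ) (h0 : ∀ x, HasDerivAt f (f₁ x) x)
    (h1 : ∀ x, HasDerivAt f₁ (f₂ x) x)
    (h2 : ∀ x, HasDerivAt f₂ (4 * s x * f₁ x + 2 * s' x * f x) x) (x₀ : ℝ)
    (e0 : f x₀ = 0) (e1 : f₁ x₀ = 0) (e2 : f₂ x₀ = 0) (x : ℝ) : f x = 0 := by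
  have hS0 : 0 ≤ S := (abs_nonneg _).trans (hS 0)
  have hS0' : 0 ≤ S' := (abs_nonneg _).trans (hS' 0)
  let V : ℝ → ℝ × ℝ × ℝ → ℝ × ℝ × ℝ := fun t y => (y.2.1, y.2.2, 4 * s t * y.2.1 + 2 * s' t * y.1)
  let K : NNReal := ⟨1 + 4 * S + 2 * S', by positivity⟩
  have hV : ∀ t, LipschitzOnWith K (V t) Set.univ := by
    intro t
    refine LipschitzOnWith.of_dist_le_mul fun y _ z _ => ?_
    change _ ≤ (1 + 4 * S + 2 * S') * dist y z
    have d1 : |y.1 - z.1| ≤ dist y z := by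
      rw [Prod.dist_eq]; exact le_max_left _ _
    have d2 : |y.2.1 - z.2.1| ≤ dist y z := by
      rw [Prod.dist_eq, Prod.dist_eq (x := y.2)]
      exact (le_max_left _ _).trans (le_max_right _ _)
    have d3 : |y.2.2 - z.2.2| ≤ dist y z := by
      rw [Prod.dist_eq, Prod.dist_eq (x := y.2)]
      exact (le_max_right _ _).trans (le_max_right _ _)
    have d0 : 0 ≤ dist y z := dist_nonneg
    have p1 : 0 ≤ S * dist y z := by positivity
    have p2 : 0 ≤ S' * dist y z := by positivity
    rw [Prod.dist_eq, Prod.dist_eq (x := (V t y).2)]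
    refine max_le ?_ (max_le ?_ ?_)
    · change |y.2.1 - z.2.1| ≤ _
      nlinarith
    · change |y.2.2 - z.2.2| ≤ _
      nlinarith
    · change |(4 * s t * y.2.1 + 2 * s' t * y.1) - (4 * s t * z.2.1 + 2 * s' t * z.1)| ≤ _
      have : (4 * s t * y.2.1 + 2 * s' t * y.1) - (4 * s t * z.2.1 + 2 * s' t * z.1) =
        4 * (s t * (y.2.1 - z.2.1)) + 2 * (s' t * (y.1 - z.1)) := by ring
      rw [this]
      have q1 : |s t * (y.2.1 - z.2.1)| ≤ S * dist y z := by
        rw [abs_mul]; exact mul_le_mul (hS t) d2 (abs_nonneg _) hS0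
      have q2 : |s' t * (y.1 - z.1)| ≤ S' * dist y z := by
        rw [abs_mul]; exact mul_le_mul (hS' t) d1 (abs_nonneg _) hS0'
      rw [abs_le] at q1 q2 ⊢
      constructor <;> linarith [q1.1, q1.2, q2.1, q2.2]
  have := ODE_solution_unique_univ (v := V) (K := K) (s := fun _ => Set.univ)
    (f := fun t => (f t, f₁ t, f₂ t)) (g := fun _ => 0) (t₀ := x₀) hV
    (fun t => ⟨(h0 t).prodMk ((h1 t).prodMk (h2 t)), trivial⟩)
    (fun t => ⟨by
      have : V t 0 = 0 := by simp [V]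
      rw [this]; exact hasDerivAt_const _ _, trivial⟩)
    (by simp [e0, e1, e2])
  exact congrArg Prod.fst (congrFun this x)

/-! ### Bounded solutions when the first integral is nonnegative. -/

/-- A function `f ≢ 0` with `f f'' - f'²/2 - 2 s f² = c ≥ 0` is up to sign a sum of two squares of
solutions of `Φ'' = s Φ`; if it is bounded, so is a nonzero solution. -/
theorem exists_bounded_solution_of_nonneg (s s' : ℝ → ℝ) (hs : ∀ x, HasDerivAt s (s' x) x)
    (S S' : ℝ) (hS : ∀ x, |s x| ≤ S) (hS' : ∀ x, |s' x| ≤ S') (f f₁ f₂ : ℝ → ℝ)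
    (h0 : ∀ x, HasDerivAt f (f₁ x) x) (h1 : ∀ x, HasDerivAt f₁ (f₂ x) x)
    (h2 : ∀ x, HasDerivAt f₂ (4 * s x * f₁ x + 2 * s' x * f x) x) (c : ℝ) (hc : 0 ≤ c)
    (x₀ : ℝ) (he : f₂ x₀ * f x₀ - 1 / 2 * f₁ x₀ ^ 2 - 2 * s x₀ * f x₀ ^ 2 = c)
    (hf0 : f x₀ ≠ 0) (M : ℝ) (hM : ∀ x, |f x| ≤ M) :
    ∃ Φ Φ' : ℝ → ℝ, (∀ x, HasDerivAt Φ (Φ' x) x) ∧ (∀ x, HasDerivAt Φ' (s x * Φ x) x) ∧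
      (∃ x, Φ x ≠ 0) ∧ ∃ B, ∀ x, |Φ x| ≤ B := by
  wlog hpos : 0 < f x₀ generalizing f f₁ f₂
  · refine this (fun x => -f x) (fun x => -f₁ x) (fun x => -f₂ x) (fun x => (h0 x).neg)
      (fun x => (h1 x).neg) (fun x => ?_) ?_ (neg_ne_zero.2 hf0) (fun x => by simpa using hM x)
      (neg_pos.2 (lt_of_le_of_ne (not_lt.1 hpos) hf0))
    · refine (h2 x).neg.congr_deriv ?_; ring
    · rw [← he]; ring
  have hsc : Continuous s := continuous_iff_continuousAt.2 fun x => (hs x).continuousAt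
  have hq : Real.sqrt (f x₀) ≠ 0 := (Real.sqrt_pos.2 hpos).ne'
  have hq2 : Real.sqrt (f x₀) ^ 2 = f x₀ := Real.sq_sqrt hpos.le
  -- The initial data make Φ² + Ψ² agree with f to second order at x₀: Φ matches f and f', and Ψ,
  -- which vanishes at x₀, contributes only 2Ψ'² = c/f to the second derivative. This is where c ≥ 0
  -- is needed.
  obtain ⟨Φ, Φ', a0, a1, a2, a3⟩ := exists_hill_solution s hsc S hS x₀ (Real.sqrt (f x₀))
    (f₁ x₀ / (2 * Real.sqrt (f x₀)))
  obtain ⟨Ψ, Ψ', b0, b1, b2, b3⟩ := exists_hill_solution s hsc S hS x₀ 0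
    (Real.sqrt (c / (2 * f x₀)))
  have hr2 : Real.sqrt (c / (2 * f x₀)) ^ 2 = c / (2 * f x₀) := Real.sq_sqrt (by positivity)
  have key : ∀ x, f x - (Φ x ^ 2 + Ψ x ^ 2) = 0 := by
    refine eq_zero_of_third_order s s' S S' hS hS' _
      (fun x => f₁ x - (2 * Φ x * Φ' x + 2 * Ψ x * Ψ' x))
      (fun x => f₂ x - (2 * Φ' x ^ 2 + 2 * s x * Φ x ^ 2 + (2 * Ψ' x ^ 2 + 2 * s x * Ψ x ^ 2)))
      (fun x => ?_) (fun x => ?_) (fun x => ?_) x₀ ?_ ?_ ?_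
    · refine ((h0 x).sub (((a2 x).pow 2).add ((b2 x).pow 2))).congr_deriv ?_
      simp
    · refine ((h1 x).sub ((((a2 x).const_mul 2).mul (a3 x)).add
        (((b2 x).const_mul 2).mul (b3 x)))).congr_deriv ?_
      ring
    · refine ((h2 x).sub (((((a3 x).pow 2).const_mul 2).add
        (((hs x).const_mul 2).mul ((a2 x).pow 2))).add ((((b3 x).pow 2).const_mul 2).add
        (((hs x).const_mul 2).mul ((b2 x).pow 2))))).congr_deriv ?_
      simp only [Pi.pow_apply]
      push_cast
      ring
    · simp only [a0, b0, hq2]; ring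
    · simp only [a0, a1, b0]; field_simp; ring
    · simp only [a0, a1, b0, b1, hq2, hr2, div_pow, mul_pow]
      have : f₂ x₀ = (c + 1 / 2 * f₁ x₀ ^ 2 + 2 * s x₀ * f x₀ ^ 2) / f x₀ := by
        rw [eq_div_iff hf0]; linarith
      rw [this]; field_simp; ring
  refine ⟨Φ, Φ', a2, a3, ⟨x₀, by rw [a0]; exact hq⟩, Real.sqrt M, fun x => ?_⟩
  refine Real.abs_le_sqrt ?_
  have := key x
  have := (abs_le.1 (hM x)).2
  nlinarith [sq_nonneg (Ψ x)]

/-! ### Derivative estimates of Landau and Barbalat type. -/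

/-- The mean value theorem gives a point within distance 1 on either side of x where f' is at most
2M in size, and f' + Ky is increasing. A one-sided bound on f'' suffices, which matters for
`wVal_regularity`. -/
theorem abs_deriv_le_of_le_second_deriv (f f₁ f₂ : ℝ → ℝ) (h0 : ∀ x, HasDerivAt f (f₁ x) x)
    (h1 : ∀ x, HasDerivAt f₁ (f₂ x) x) (M K : ℝ) (hM : ∀ x, |f x| ≤ M) (hK : ∀ x, -K ≤ f₂ x)
    (hK0 : 0 ≤ K) (x : ℝ) : |f₁ x| ≤ 2 * M + K := by
  have hmono : Monotone fun y => f₁ y + K * y := by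
    refine monotone_of_hasDerivAt_nonneg (f' := fun y => f₂ y + K * 1)
      (fun y => (h1 y).add ((hasDerivAt_id y).const_mul K)) (fun y => ?_)
    have := hK y
    simp only [Pi.zero_apply]
    linarith
  have mvt : ∀ a, ∃ ξ ∈ Ioo a (a + 1), f₁ ξ = f (a + 1) - f a := by
    intro a
    obtain ⟨ξ, h, e⟩ := exists_hasDerivAt_eq_slope f f₁ (lt_add_one a)
      (fun y _ => (h0 y).continuousAt.continuousWithinAt) (fun y _ => h0 y)
    exact ⟨ξ, h, by rw [e]; simp⟩
  have b1 := abs_le.1 (hM (x + 1))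
  have b2 := abs_le.1 (hM x)
  have b3 := abs_le.1 (hM (x - 1))
  rw [abs_le]
  constructor
  · obtain ⟨ξ, h, e⟩ := mvt (x - 1)
    rw [sub_add_cancel] at h e
    have := hmono h.2.le
    simp only at this
    nlinarith [h.1]
  · obtain ⟨ξ, h, e⟩ := mvt x
    have := hmono h.1.le
    simp only at this
    nlinarith [h.2]

/-- Over a step h the increment of f differs from h f' by at most K h², and it tends to 0 along l; h
is then taken small compared with ε. Shift invariance of l covers both ends of the line. -/
theorem tendsto_deriv_zero_of_tendsto (l : Filter ℝ) (hl : ∀ h : ℝ, Tendsto (fun x => x + h) l l)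
    (f f₁ f₂ : ℝ → ℝ) (h0 : ∀ x, HasDerivAt f (f₁ x) x) (h1 : ∀ x, HasDerivAt f₁ (f₂ x) x)
    (K : ℝ) (hK : ∀ x, |f₂ x| ≤ K) (a : ℝ) (hf : Tendsto f l (𝓝 a)) :
    Tendsto f₁ l (𝓝 0) := by
  have hK0 : 0 ≤ K := (abs_nonneg _).trans (hK 0)
  have key : ∀ h > 0, ∀ x, h * |f₁ x| ≤ |f (x + h) - f x| + K * h ^ 2 := by
    intro h hh x
    obtain ⟨ξ, hξ, e⟩ := exists_hasDerivAt_eq_slope f f₁ (lt_add_of_pos_right x hh)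
      (fun y _ => (h0 y).continuousAt.continuousWithinAt) (fun y _ => h0 y)
    rw [add_sub_cancel_left, eq_div_iff hh.ne'] at e
    have hlip := Convex.norm_image_sub_le_of_norm_hasDerivWithin_le (f := f₁) (f' := f₂) (C := K)
      (s := Set.univ) (x := ξ) (y := x) (fun y _ => (h1 y).hasDerivWithinAt) (fun y _ => hK y)
      convex_univ trivial trivial
    rw [Real.norm_eq_abs, Real.norm_eq_abs, abs_sub_comm x ξ, abs_of_pos (sub_pos.2 hξ.1)] at hlip
    have h3 : |f₁ x| ≤ |f₁ ξ| + |f₁ x - f₁ ξ| := by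
      have := abs_add_le (f₁ ξ) (f₁ x - f₁ ξ)
      rwa [add_sub_cancel] at this
    rw [← e, abs_mul, abs_of_pos hh]
    have h4 : |f₁ x - f₁ ξ| ≤ K * h :=
      hlip.trans (mul_le_mul_of_nonneg_left (by linarith [hξ.2]) hK0)
    nlinarith
  rw [Metric.tendsto_nhds]
  intro ε hε
  set h := ε / (2 * (K + 1)) with hh
  have hpos : 0 < h := by positivity
  have hd : Tendsto (fun x => f (x + h) - f x) l (𝓝 0) := by
    simpa using (hf.comp (hl h)).sub hf
  filter_upwards [Metric.tendsto_nhds.1 hd (h * (ε / 2)) (by positivity)] with x hx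
  rw [Real.dist_eq, sub_zero] at hx ⊢
  have hk := key h hpos x
  have : K * h ^ 2 < h * (ε / 2) := by
    have e : ε / 2 = h * (K + 1) := by rw [hh]; field_simp
    rw [e]; nlinarith [sq_nonneg h, mul_pos hpos hpos]
  nlinarith

/-! ### Calculus of bounded functions. -/

/-- A function on the line that is bounded. -/
def IsBddFun (f : ℝ → ℝ) : Prop := ∃ M, ∀ x, |f x| ≤ M

namespace IsBddFun

variable {f g : ℝ → ℝ}

theorem const (c : ℝ) : IsBddFun fun _ => c := ⟨|c|, fun _ => le_rfl⟩

theorem add (hf : IsBddFun f) (hg : IsBddFun g) : IsBddFun fun x => f x + g x := by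
  obtain ⟨M, hM⟩ := hf
  obtain ⟨K, hK⟩ := hg
  exact ⟨M + K, fun x => (abs_add_le _ _).trans (add_le_add (hM x) (hK x))⟩

theorem mul (hf : IsBddFun f) (hg : IsBddFun g) : IsBddFun fun x => f x * g x := by
  obtain ⟨M, hM⟩ := hf
  obtain ⟨K, hK⟩ := hg
  refine ⟨M * K, fun x => ?_⟩
  rw [abs_mul]
  exact mul_le_mul (hM x) (hK x) (abs_nonneg _) ((abs_nonneg _).trans (hM 0))

theorem neg (hf : IsBddFun f) : IsBddFun fun x => -f x := by
  obtain ⟨M, hM⟩ := hf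
  exact ⟨M, fun x => by simpa using hM x⟩

theorem sub (hf : IsBddFun f) (hg : IsBddFun g) : IsBddFun fun x => f x - g x := by
  simpa [sub_eq_add_neg] using hf.add hg.neg

theorem const_mul (c : ℝ) (hf : IsBddFun f) : IsBddFun fun x => c * f x := (const c).mul hf

theorem pow (hf : IsBddFun f) (n : ℕ) : IsBddFun fun x => f x ^ n := by
  obtain ⟨M, hM⟩ := hf
  exact ⟨M ^ n, fun x => by rw [abs_pow]; exact pow_le_pow_left₀ (abs_nonneg _) (hM x) n⟩

theorem sum {ι : Type*} (t : Finset ι) {F : ι → ℝ → ℝ} (h : ∀ i ∈ t, IsBddFun (F i)) :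
    IsBddFun fun x => ∑ i ∈ t, F i x := by
  classical
  induction t using Finset.induction_on with
  | empty => simpa using const 0
  | insert a t ha ih =>
    simp only [Finset.sum_insert ha]
    exact (h a (by simp)).add (ih fun i hi => h i (by simp [hi]))

theorem tendsto_mul_zero (hf : IsBddFun f) {l : Filter ℝ} (hg : Tendsto g l (𝓝 0)) :
    Tendsto (fun x => f x * g x) l (𝓝 0) := by
  obtain ⟨M, hM⟩ := hf
  have : Tendsto (fun x => M * |g x|) l (𝓝 0) := by simpa using hg.abs.const_mul M
  refine squeeze_zero_norm (fun x => ?_) this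
  rw [norm_mul]
  exact mul_le_mul_of_nonneg_right (hM x) (abs_nonneg _)

end IsBddFun

/-! ### No bounded solution when the first integral is negative. -/

/-- If `w w'' - w'²/2 - 2 s w² = c < 0` for a bounded solution `w` of the third order equation
which is part of a pencil of solutions with bounded derivative `v`, then `ψ'' = s ψ` has no bounded
solution other than zero. -/
theorem eq_zero_of_bounded_of_neg (s s' : ℝ → ℝ) (hs : ∀ x, HasDerivAt s (s' x) x)
    (bs : IsBddFun s) (w w₁ w₂ v v₁ v₂ : ℝ → ℝ)
    (hw0 : ∀ x, HasDerivAt w (w₁ x) x) (hw1 : ∀ x, HasDerivAt w₁ (w₂ x) x)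
    (hw2 : ∀ x, HasDerivAt w₂ (4 * s x * w₁ x + 2 * s' x * w x) x)
    (hv0 : ∀ x, HasDerivAt v (v₁ x) x) (hv1 : ∀ x, HasDerivAt v₁ (v₂ x) x)
    (hv2 : ∀ x, HasDerivAt v₂ (4 * s x * v₁ x + 2 * s' x * v x - 2 * w₁ x) x)
    (bw0 : IsBddFun w) (bw1 : IsBddFun w₁) (bw2 : IsBddFun w₂)
    (bv0 : IsBddFun v) (bv1 : IsBddFun v₁) (bv2 : IsBddFun v₂)
    (c : ℝ) (hc : c < 0) (he : ∀ x, w₂ x * w x - 1 / 2 * w₁ x ^ 2 - 2 * s x * w x ^ 2 = c)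
    (ψ ψ₁ : ℝ → ℝ) (hψ0 : ∀ x, HasDerivAt ψ (ψ₁ x) x) (hψ1 : ∀ x, HasDerivAt ψ₁ (s x * ψ x) x)
    (bψ : IsBddFun ψ) (x : ℝ) : ψ x = 0 := by
  have bψ2 : IsBddFun fun x => s x * ψ x := bs.mul bψ
  have bψ1 : IsBddFun ψ₁ := by
    obtain ⟨M, hM⟩ := bψ
    obtain ⟨K, hK⟩ := bψ2
    exact ⟨2 * M + K, abs_deriv_le_of_le_second_deriv ψ ψ₁ _ hψ0 hψ1 M K hM
      (fun y => (abs_le.1 (hK y)).1) ((abs_nonneg _).trans (hK 0))⟩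
  -- η = Tψ is again a solution of the same equation, and applying T twice gives Tη = -(c/2)ψ.
  let η : ℝ → ℝ := fun x => w x * ψ₁ x - 1 / 2 * (w₁ x * ψ x)
  let η₁ : ℝ → ℝ := fun x => 1 / 2 * (w₁ x * ψ₁ x) + (w x * s x - 1 / 2 * w₂ x) * ψ x
  have bη : IsBddFun η := (bw0.mul bψ1).sub ((bw1.mul bψ).const_mul _)
  have bη1 : IsBddFun η₁ :=
    ((bw1.mul bψ1).const_mul _).add (((bw0.mul bs).sub (bw2.const_mul _)).mul bψ)
  have hη0 : ∀ x, HasDerivAt η (η₁ x) x := fun x => by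
    refine (((hw0 x).mul (hψ1 x)).sub (((hw1 x).mul (hψ0 x)).const_mul _)).congr_deriv ?_
    simp only [η₁]; ring
  have hη1 : ∀ x, HasDerivAt η₁ (s x * η x) x := fun x => by
    refine ((((hw1 x).mul (hψ1 x)).const_mul _).add ((((hw0 x).mul (hs x)).sub
      ((hw2 x).const_mul _)).mul (hψ0 x))).congr_deriv ?_
    simp only [η, Pi.mul_apply, Pi.sub_apply]; ring
  let q : ℝ → ℝ := fun x => -(1 / 4) * (-c / 2 * ψ x ^ 2 + η x ^ 2)
  let q₁ : ℝ → ℝ := fun x => -(1 / 2) * (-c / 2 * (ψ x * ψ₁ x) + η x * η₁ x)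
  -- With f = ψη, p = -¼(B + wf), where B = fv'' - f'v' + f''v - 4sfv is the bilinear concomitant of
  -- the skew-adjoint third order operator. The source -2w' in the equation of v gives B' = -2w'f,
  -- so p' = -¼(wf' - w'f) = -¼(η² - (c/2)ψ²).
  let p : ℝ → ℝ := fun x => -(1 / 2) * (v x * ψ₁ x * η₁ x) +
    1 / 4 * (v₁ x * (ψ x * η₁ x + ψ₁ x * η x)) -
    1 / 4 * ((v₂ x - 2 * (s x * v x)) * ψ x * η x) - 1 / 4 * (w x * ψ x * η x)
  have hq : ∀ x, HasDerivAt q (q₁ x) x := fun x => by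
    refine (((((hψ0 x).pow 2).const_mul (-c / 2)).add ((hη0 x).pow 2)).const_mul
      (-(1 / 4))).congr_deriv ?_
    simp only [q₁]; push_cast; ring
  have bq1 : IsBddFun q₁ :=
    (((bψ.mul bψ1).const_mul _).add (bη.mul bη1)).const_mul _
  have hp : ∀ x, HasDerivAt p (q x) x := fun x => by
    refine ((((((hv0 x).mul (hψ1 x)).mul (hη1 x)).const_mul (-(1 / 2))).add
      (((hv1 x).mul (((hψ0 x).mul (hη1 x)).add ((hψ1 x).mul (hη0 x)))).const_mul (1 / 4))).sub
      ((((((hv2 x).sub (((hs x).mul (hv0 x)).const_mul 2)).mul (hψ0 x)).mul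
        (hη0 x))).const_mul (1 / 4))).sub
      ((((hw0 x).mul (hψ0 x)).mul (hη0 x)).const_mul (1 / 4)) |>.congr_deriv ?_
    simp only [q, η, η₁, Pi.mul_apply, Pi.sub_apply, Pi.add_apply]
    rw [← he x]; ring
  have bp : IsBddFun p :=
    ((((bv0.mul bψ1).mul bη1).const_mul _).add ((bv1.mul ((bψ.mul bη1).add
      (bψ1.mul bη))).const_mul _)).sub ((((bv2.sub ((bs.mul bv0).const_mul 2)).mul bψ).mul
      bη).const_mul _) |>.sub (((bw0.mul bψ).mul bη).const_mul _)
  have hqn : ∀ x, q x ≤ 0 := fun x => by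
    have : 0 ≤ -c / 2 * ψ x ^ 2 := mul_nonneg (by linarith) (sq_nonneg _)
    simp only [q]; nlinarith [sq_nonneg (η x)]
  have hanti : Antitone p := antitone_of_hasDerivAt_nonpos hp hqn
  -- Once p converges, q = p' tends to 0. Both squares in q have the same sign, so ψ tends to 0,
  -- then ψ' does, and each term of p contains one of these factors.
  have hlim : ∀ l : Filter ℝ, (∀ h : ℝ, Tendsto (fun x => x + h) l l) →
      (∃ a, Tendsto p l (𝓝 a)) → Tendsto p l (𝓝 0) := by
    rintro l hl ⟨a, ha⟩
    obtain ⟨K, hK⟩ := bq1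
    have hq0 := tendsto_deriv_zero_of_tendsto l hl p q q₁ hp hq K hK a ha
    have hsq : Tendsto (fun x => ψ x ^ 2) l (𝓝 0) := by
      have : Tendsto (fun x => (8 / c) * q x) l (𝓝 0) := by simpa using hq0.const_mul (8 / c)
      refine squeeze_zero (fun x => sq_nonneg _) (fun x => ?_) this
      have e : (8 / c) * q x = ψ x ^ 2 + (-2 / c) * η x ^ 2 := by
        have := hc.ne
        simp only [q]; field_simp; ring
      rw [e]
      have : 0 ≤ -2 / c := div_nonneg_of_nonpos (by norm_num) hc.le
      nlinarith [mul_nonneg this (sq_nonneg (η x))]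
    have tψ : Tendsto ψ l (𝓝 0) := by
      have h := hsq.sqrt
      simp only [Real.sqrt_sq_eq_abs, Real.sqrt_zero] at h
      exact (tendsto_zero_iff_abs_tendsto_zero _).2 h
    obtain ⟨K', hK'⟩ := bψ2
    have tψ1 := tendsto_deriv_zero_of_tendsto l hl ψ ψ₁ _ hψ0 hψ1 K' hK' 0 tψ
    have t1 := (bv0.mul bη1).tendsto_mul_zero tψ1
    have t2 := (bv1.mul bη1).tendsto_mul_zero tψ
    have t3 := (bv1.mul bη).tendsto_mul_zero tψ1
    have t4 := ((bv2.sub ((bs.mul bv0).const_mul 2)).mul bη).tendsto_mul_zero tψ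
    have t5 := (bw0.mul bη).tendsto_mul_zero tψ
    have := ((((t1.const_mul (-(1 / 2))).add ((t2.add t3).const_mul (1 / 4))).sub
      (t4.const_mul (1 / 4)))).sub (t5.const_mul (1 / 4))
    simp only [mul_zero, add_zero, sub_zero] at this
    refine this.congr fun x => ?_
    simp only [p]; ring
  obtain ⟨B, hB⟩ := bp
  have h1 : Tendsto p atTop (𝓝 0) := hlim _ (fun h => tendsto_atTop_add_const_right _ h tendsto_id)
    ⟨_, tendsto_atTop_ciInf hanti ⟨-B, by rintro _ ⟨y, rfl⟩; exact (abs_le.1 (hB y)).1⟩⟩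
  have h2 : Tendsto p atBot (𝓝 0) := hlim _ (fun h => tendsto_atBot_add_const_right _ h tendsto_id)
    ⟨_, tendsto_atBot_ciSup hanti ⟨B, by rintro _ ⟨y, rfl⟩; exact (abs_le.1 (hB y)).2⟩⟩
  have hp0 : p = fun _ => 0 := by
    funext y
    exact le_antisymm (hanti.ge_of_tendsto h2 y) (hanti.le_of_tendsto h1 y)
  have hqx : q x = 0 := by
    have := hp x
    rw [hp0] at this
    exact this.unique (hasDerivAt_const x 0)
  have h3 : -c / 2 * ψ x ^ 2 + η x ^ 2 = 0 := by simpa [q] using hqx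
  have h4 : ψ x ^ 2 = 0 := by nlinarith [sq_nonneg (η x), sq_nonneg (ψ x)]
  exact pow_eq_zero_iff two_ne_zero |>.1 h4

/-! ### Reality of the roots. -/

/-- The spectral parameter at a zero of the spectral polynomial is real: `w = a + b i` solves
`w w'' - w'²/2 + (μ - u) w² = 0` with `β = Im μ`, it is bounded, and bounded away from zero. -/
theorem im_eq_zero_of_bounded_complex_solution (u a a₁ a₂ b b₁ b₂ : ℝ → ℝ) (α β : ℝ)
    (ha0 : ∀ x, HasDerivAt a (a₁ x) x) (ha1 : ∀ x, HasDerivAt a₁ (a₂ x) x)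
    (hb0 : ∀ x, HasDerivAt b (b₁ x) x) (hb1 : ∀ x, HasDerivAt b₁ (b₂ x) x)
    (ba0 : IsBddFun a) (ba1 : IsBddFun a₁) (bb0 : IsBddFun b) (bb1 : IsBddFun b₁)
    (δ : ℝ) (hδ : 0 < δ) (hab : ∀ x, δ ≤ a x ^ 2 + b x ^ 2)
    (heq : ∀ x, ((a₂ x : ℂ) + b₂ x * Complex.I) * (a x + b x * Complex.I) -
      1 / 2 * (a₁ x + b₁ x * Complex.I) ^ 2 +
      ((α + β * Complex.I) - u x) * (a x + b x * Complex.I) ^ 2 = 0) : β = 0 := by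
  have hpos : ∀ x, 0 < a x ^ 2 + b x ^ 2 := fun x => hδ.trans_le (hab x)
  let R : ℝ → ℝ := fun x => Real.sqrt (a x ^ 2 + b x ^ 2)
  have hR : ∀ x, 0 < R x := fun x => Real.sqrt_pos.2 (hpos x)
  have hR2 : ∀ x, R x ^ 2 = a x ^ 2 + b x ^ 2 := fun x => Real.sq_sqrt (hpos x).le
  have hRδ : ∀ x, Real.sqrt δ ≤ R x := fun x => Real.sqrt_le_sqrt (hab x)
  -- If a + bi = φ², then R = |φ|² and G = 2 Im(φ̄φ'), a Wronskian of φ and its conjugate. The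
  -- formula in a and b avoids choosing a square root.
  let G : ℝ → ℝ := fun x => (a x * b₁ x - b x * a₁ x) / R x
  have hG : ∀ x, HasDerivAt G (-β * R x) x := by
    intro x
    have hRd : HasDerivAt R ((a x * a₁ x + b x * b₁ x) / R x) x := by
      refine ((((ha0 x).pow 2).add ((hb0 x).pow 2)).sqrt (hpos x).ne').congr_deriv ?_
      simp only [R, Pi.add_apply, Pi.pow_apply]
      push_cast
      have := (hR x).ne'
      simp only [R] at this
      field_simp
    refine ((((ha0 x).mul (hb1 x)).sub ((hb0 x).mul (ha1 x))).div hRd (hR x).ne').congr_deriv ?_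
    have hre := congrArg Complex.re (heq x)
    have him := congrArg Complex.im (heq x)
    simp [pow_two] at hre him
    have hRx := hR2 x
    have hne := (hR x).ne'
    simp only [Pi.mul_apply, Pi.sub_apply]
    rw [div_eq_iff (pow_ne_zero 2 hne)]
    field_simp
    linear_combination (a x ^ 2 - b x ^ 2) * him - 2 * (a x * b x) * hre +
      (a x * b₂ x - b x * a₂ x + β * (R x ^ 2 + (a x ^ 2 + b x ^ 2))) * hRx
  have bG : IsBddFun G := by
    obtain ⟨M, hM⟩ := (ba0.mul bb1).sub (bb0.mul ba1)
    refine ⟨M / Real.sqrt δ, fun x => ?_⟩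
    simp only [G, abs_div, abs_of_pos (hR x)]
    exact div_le_div₀ ((abs_nonneg _).trans (hM x)) (hM x) (Real.sqrt_pos.2 hδ) (hRδ x)
  obtain ⟨M, hM⟩ := bG
  by_contra hβ
  have hd : 0 < Real.sqrt δ := Real.sqrt_pos.2 hδ
  -- Over an interval of this length G would change by at least 2M + 1, more than |G| ≤ M permits.
  set T := (2 * M + 1) / (|β| * Real.sqrt δ) with hT
  have hM0 : 0 ≤ M := (abs_nonneg _).trans (hM 0)
  have hTpos : 0 < T := by positivity
  obtain ⟨ξ, -, e⟩ := exists_hasDerivAt_eq_slope G _ hTpos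
    (fun y _ => (hG y).continuousAt.continuousWithinAt) (fun y _ => hG y)
  rw [sub_zero, eq_div_iff hTpos.ne'] at e
  have h1 : |G T - G 0| ≤ 2 * M := by
    have h1 := abs_le.1 (hM T)
    have h2 := abs_le.1 (hM 0)
    rw [abs_le]; constructor <;> linarith
  rw [← e, abs_mul, abs_mul, abs_neg, abs_of_pos (hR ξ), abs_of_pos hTpos] at h1
  have h2 : |β| * Real.sqrt δ * T = 2 * M + 1 := by
    rw [hT]; field_simp
  have h3 : |β| * Real.sqrt δ * T ≤ |β| * R ξ * T := by
    gcongr; exact hRδ ξ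
  linarith

/-! ### Sign of a product of real linear factors, and the bands. -/

/-- Induction removing the two largest roots: below both, their factors have positive product;
between them the sign is negative; above both everything is nonnegative. Coinciding roots are
allowed, so bands may be points and gaps may be empty. -/
theorem prod_range_sub_nonneg_iff (r : ℕ → ℝ) (hr : Monotone r) (N : ℕ) (t : ℝ) :
    0 ≤ ∏ i ∈ Finset.range (2 * N + 1), (t - r i) ↔
      (∃ i < N, r (2 * i) ≤ t ∧ t ≤ r (2 * i + 1)) ∨ r (2 * N) ≤ t := by
  induction N with
  | zero => simp
  | succ N ih =>
    have e : 2 * (N + 1) + 1 = 2 * N + 1 + 1 + 1 := by ring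
    have m1 : r (2 * N) ≤ r (2 * N + 1) := hr (by omega)
    have m2 : r (2 * N + 1) ≤ r (2 * N + 2) := hr (by omega)
    have e2 : 2 * (N + 1) = 2 * N + 2 := by ring
    rw [e, Finset.prod_range_succ, Finset.prod_range_succ, e2]
    have low : ∀ i, i ≤ 2 * N → r i ≤ r (2 * N) := fun i hi => hr hi
    rcases lt_or_ge t (r (2 * N + 1)) with h | h
    · have hpos : 0 < (t - r (2 * N + 1)) * (t - r (2 * N + 1 + 1)) :=
        mul_pos_of_neg_of_neg (by linarith) (by linarith)
      rw [mul_assoc, mul_nonneg_iff_of_pos_right hpos, ih]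
      constructor
      · rintro (⟨i, hi, h1⟩ | h1)
        · exact Or.inl ⟨i, by omega, h1⟩
        · exact Or.inl ⟨N, by omega, h1, h.le⟩
      · rintro (⟨i, hi, h1⟩ | h1)
        · rcases Nat.lt_succ_iff_lt_or_eq.1 hi with hi | rfl
          · exact Or.inl ⟨i, hi, h1⟩
          · exact Or.inr h1.1
        · linarith
    · have hnn : 0 ≤ ∏ i ∈ Finset.range (2 * N + 1), (t - r i) :=
        Finset.prod_nonneg fun i hi => by
          have := low i (by simp at hi; omega)
          linarith
      rcases h.eq_or_lt with h | h
      · refine iff_of_true (by simp [h]) (Or.inl ⟨N, by omega, by linarith, h.ge⟩)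
      · rcases lt_or_ge t (r (2 * N + 2)) with h' | h'
        · refine iff_of_false (not_le.2 (mul_neg_of_pos_of_neg (mul_pos
            (Finset.prod_pos fun i hi => ?_) (by linarith)) (by linarith))) ?_
          · have := low i (by simp at hi; omega)
            linarith
          · rintro (⟨i, hi, h1⟩ | h1)
            · have : r (2 * i + 1) ≤ r (2 * N + 1) := hr (by omega)
              linarith
            · linarith
        · exact iff_of_true (mul_nonneg (mul_nonneg hnn (by linarith)) (by linarith)) (Or.inr h')

theorem bands_eq_setOf_nonneg {N : ℕ} (r : Fin (2 * N + 1) → ℝ) (hr : Monotone r) :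
    bands r = {t : ℝ | 0 ≤ ∏ i, (t - r i)} := by
  -- Extending r by its last value keeps the sequence monotone on ℕ.
  let R : ℕ → ℝ := fun i => r ⟨min i (2 * N), by omega⟩
  have hR : Monotone R := fun i j h => hr (by simp only [Fin.mk_le_mk]; omega)
  have hval : ∀ i (h : i < 2 * N + 1), R i = r ⟨i, h⟩ := fun i h => by
    simp only [R]; congr 2; omega
  ext t
  have hprod : ∏ i, (t - r i) = ∏ i ∈ Finset.range (2 * N + 1), (t - R i) := by
    rw [← Fin.prod_univ_eq_prod_range (fun i => t - R i)]
    exact Finset.prod_congr rfl fun i _ => by rw [hval i i.2]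
  rw [mem_ofPred_eq, hprod, prod_range_sub_nonneg_iff R hR]
  simp only [bands, mem_union, mem_iUnion, mem_Icc, mem_Ici]
  refine or_congr ⟨?_, ?_⟩ ?_
  · rintro ⟨i, h⟩
    exact ⟨i, i.2, by rwa [hval _ (by omega), hval _ (by omega)]⟩
  · rintro ⟨i, hi, h⟩
    rw [hval _ (by omega), hval _ (by omega)] at h
    exact ⟨⟨i, hi⟩, h⟩
  · rw [hval _ (by omega)]; rfl

theorem exists_monotone_roots_of_forall_im_eq_zero {P : ℝ[X]} {n : ℕ} (hP : P.Monic)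
    (hn : P.natDegree = n) (h : ∀ z : ℂ, aeval z P = 0 → z.im = 0) :
    ∃ r : Fin n → ℝ, Monotone r ∧ P = ∏ i, (X - C (r i)) := by
  have hs : P.Splits := by
    refine Splits.of_splits_map (algebraMap ℝ ℂ) (IsAlgClosed.splits _) fun z hz => ?_
    have h1 : aeval z P = 0 := by
      rw [← eval_map_algebraMap]; exact (mem_roots'.1 hz).2
    exact ⟨z.re, Complex.ext rfl (by simp [h z h1])⟩
  have hcard : P.roots.toList.length = n := by
    rw [Multiset.length_toList, ← hs.natDegree_eq_card_roots, hn]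
  let r₀ : Fin n → ℝ := fun i => P.roots.toList.get (i.cast hcard.symm)
  refine ⟨r₀ ∘ Tuple.sort r₀, Tuple.monotone_sort r₀, ?_⟩
  have e1 : ∏ i, (X - C ((r₀ ∘ Tuple.sort r₀) i)) = ∏ i, (X - C (r₀ i)) :=
    Equiv.prod_comp (Tuple.sort r₀) fun i => X - C (r₀ i)
  rw [e1]
  conv_lhs => rw [hs.eq_prod_roots_of_monic hP, ← Multiset.coe_toList P.roots]
  rw [Multiset.map_coe, Multiset.prod_coe]
  subst hcard
  rw [← Fin.prod_univ_fun_getElem]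
  rfl

/-! ### The pencil w(x; ·) as a polynomial. -/

/-- The polynomial `c₀ μ^(N-1) + ⋯ + c_(N-1)`. -/
noncomputable def lowPoly {N : ℕ} (c : Fin N → ℝ) : ℝ[X] := ∑ j : Fin N, C (c j) * X ^ (N - 1 - (j : ℕ))

/-- The polynomial `w(x; ·)`. -/
noncomputable def wPoly {N : ℕ} (w : Fin N → ℝ → ℝ) (x : ℝ) : ℝ[X] := X ^ N + lowPoly fun j => w j x

section lowPoly

variable {N : ℕ}

theorem eval_wPoly (w : Fin N → ℝ → ℝ) (x μ : ℝ) : (wPoly w x).eval μ = wVal w μ x := by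
  simp [wPoly, lowPoly, wVal, eval_finsetSum]

theorem map_lowPoly (φ : ℝ[X] →ₗ[ℝ] ℝ) (c : Fin N → ℝ) :
    φ (lowPoly c) = ∑ j : Fin N, c j * φ (X ^ (N - 1 - (j : ℕ))) := by
  simp [lowPoly, map_sum, ← smul_eq_C_mul]

theorem degree_lowPoly_lt (c : Fin N → ℝ) : (lowPoly c).degree < N := by
  refine (degree_sum_le _ _).trans_lt ((Finset.sup_lt_iff (WithBot.bot_lt_coe N)).2 fun j _ => ?_)
  refine (degree_C_mul_X_pow_le _ _).trans_lt ?_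
  exact Nat.cast_lt.2 (by omega : N - 1 - (j : ℕ) < N)

theorem coeff_lowPoly (c : Fin N → ℝ) (j : Fin N) : (lowPoly c).coeff (N - 1 - (j : ℕ)) = c j := by
  simp only [lowPoly, finsetSum_coeff, coeff_C_mul_X_pow]
  rw [Finset.sum_eq_single j]
  · simp
  · intro i _ hi
    rw [if_neg]
    intro h
    exact hi (Fin.ext (by omega))
  · simp

theorem monic_wPoly (w : Fin N → ℝ → ℝ) (x : ℝ) : (wPoly w x).Monic :=
  monic_X_pow_add (degree_lowPoly_lt _)

theorem degree_wPoly (w : Fin N → ℝ → ℝ) (x : ℝ) : (wPoly w x).degree = N :=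
  (degree_add_eq_left_of_degree_lt (by rw [degree_X_pow]; exact degree_lowPoly_lt _)).trans
    (degree_X_pow N)

/-- An arbitrary linear functional serves at once for values, Taylor coefficients, and real and
imaginary parts of values at a complex point. -/
theorem hasDerivAt_map_lowPoly (φ : ℝ[X] →ₗ[ℝ] ℝ) {w w' : Fin N → ℝ → ℝ} {x : ℝ}
    (h : ∀ j, HasDerivAt (w j) (w' j x) x) :
    HasDerivAt (fun y => φ (lowPoly fun j => w j y)) (φ (lowPoly fun j => w' j x)) x := by
  simp only [map_lowPoly]
  exact HasDerivAt.fun_sum fun j _ => (h j).mul_const _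

theorem hasDerivAt_map_wPoly (φ : ℝ[X] →ₗ[ℝ] ℝ) {w w' : Fin N → ℝ → ℝ} {x : ℝ}
    (h : ∀ j, HasDerivAt (w j) (w' j x) x) :
    HasDerivAt (fun y => φ (wPoly w y)) (φ (lowPoly fun j => w' j x)) x := by
  simp only [wPoly, map_add]
  exact (hasDerivAt_map_lowPoly φ h).const_add _

theorem isBddFun_map_lowPoly (φ : ℝ[X] →ₗ[ℝ] ℝ) {w : Fin N → ℝ → ℝ} (h : ∀ j, IsBddFun (w j)) :
    IsBddFun fun y => φ (lowPoly fun j => w j y) := by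
  simp only [map_lowPoly]
  exact IsBddFun.sum _ fun j _ => (h j).mul (IsBddFun.const _)

/-- The coefficients of a polynomial of degree less than `N` are linear in its values at `N`
points. -/
theorem exists_coeff_eq_sum_eval (N : ℕ) (b : Fin N → ℝ) (hb : Function.Injective b) :
    ∃ κ : Fin N → Fin N → ℝ, ∀ (c : Fin N → ℝ) (j : Fin N),
      c j = ∑ m, κ j m * (lowPoly c).eval (b m) := by
  refine ⟨fun j m => (Lagrange.basis Finset.univ b m).coeff (N - 1 - (j : ℕ)), fun c j => ?_⟩
  have h := Lagrange.eq_interpolate (f := lowPoly c) (s := Finset.univ) (v := b) hb.injOn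
    (by simpa using degree_lowPoly_lt c)
  conv_lhs => rw [← coeff_lowPoly c j, h]
  simp [Lagrange.interpolate_apply, mul_comm]

end lowPoly

/-! ### Bounds from the sphero-ellipsoidal representation. -/

/-- The sphero-ellipsoidal representation `w(x; μ) = ∑ᵢ ρᵢ(x) ∏_{j ≠ i} (μ - aⱼ)` where `ρ(x)`
belongs to the standard simplex. -/
def IsSpheroEllipsoidal {N : ℕ} (w : Fin N → ℝ → ℝ) (a : Fin (N + 1) → ℝ)
    (ρ : Fin (N + 1) → ℝ → ℝ) : Prop :=
  (∀ i x, 0 ≤ ρ i x) ∧ (∀ x, ∑ i, ρ i x = 1) ∧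
    ∀ x, wPoly w x = ∑ i, ρ i x • ∏ j ∈ Finset.univ.erase i, (X - C (a j))

/-- Lagrange interpolation: both sides have degree at most N and agree at the N + 1 nodes aᵢ. The
weights Xᵢ² sum to 1 on the sphere. -/
theorem ComesFromNeumann.exists_isSpheroEllipsoidal {N : ℕ} {w : Fin N → ℝ → ℝ}
    (h : ComesFromNeumann w) : ∃ a ρ, IsSpheroEllipsoidal w a ρ := by
  obtain ⟨a, Y, ha, hY, hw⟩ := h
  refine ⟨a, fun i x => Y i (x / 2) ^ 2, fun i x => sq_nonneg _, fun x => hY.mem_sphere _,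
    fun x => ?_⟩
  have hdeg : (∑ i, Y i (x / 2) ^ 2 • ∏ j ∈ Finset.univ.erase i, (X - C (a j))).degree
      < ((Finset.univ : Finset (Fin (N + 1))).card : WithBot ℕ) := by
    refine (degree_sum_le _ _).trans_lt
      ((Finset.sup_lt_iff (WithBot.bot_lt_coe _)).2 fun i _ => ?_)
    refine (degree_smul_le _ _).trans_lt ?_
    rw [degree_prod]
    simp only [degree_X_sub_C, Finset.sum_const, Finset.card_erase_of_mem (Finset.mem_univ _),
      Finset.card_univ, Fintype.card_fin]
    rw [nsmul_one]
    exact Nat.cast_lt.2 (by omega)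
  refine eq_of_degrees_lt_of_eval_index_eq Finset.univ (v := a) ha.injective.injOn ?_ hdeg
    fun i _ => ?_
  · rw [degree_wPoly]
    exact Nat.cast_lt.2 (by simp)
  · rw [eval_wPoly, eval_finsetSum, Finset.sum_eq_single i]
    · rw [eval_smul, eval_prod]
      beta_reduce
      rw [hw x i]
      have : ∏ j ∈ Finset.univ.erase i, (a i - a j) ≠ 0 :=
        Finset.prod_ne_zero_iff.2 fun j hj =>
          sub_ne_zero.2 fun e => (Finset.ne_of_mem_erase hj) (ha.injective e).symm
      simp only [eval_sub, eval_X, eval_C, smul_eq_mul]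
      rw [div_mul_cancel₀ _ this]
    · intro k _ hk
      rw [eval_smul, eval_prod, Finset.prod_eq_zero (Finset.mem_erase.2 ⟨hk.symm, Finset.mem_univ i⟩),
        smul_zero]
      simp
    · simp

namespace IsSpheroEllipsoidal

variable {N : ℕ} {w : Fin N → ℝ → ℝ} {a : Fin (N + 1) → ℝ} {ρ : Fin (N + 1) → ℝ → ℝ}

theorem isBddFun_map (h : IsSpheroEllipsoidal w a ρ) (φ : ℝ[X] →ₗ[ℝ] ℝ) :
    IsBddFun fun x => φ (wPoly w x) := by
  have hρ : ∀ i, IsBddFun (ρ i) := fun i => ⟨1, fun x => by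
    rw [abs_of_nonneg (h.1 i x), ← h.2.1 x]
    exact Finset.single_le_sum (fun j _ => h.1 j x) (Finset.mem_univ i)⟩
  simp only [h.2.2, map_sum, map_smul, smul_eq_mul]
  exact IsBddFun.sum _ fun i _ => (hρ i).mul (IsBddFun.const _)

theorem isBddFun (h : IsSpheroEllipsoidal w a ρ) (j : Fin N) : IsBddFun (w j) := by
  have h1 := (h.isBddFun_map (lcoeff ℝ (N - 1 - (j : ℕ)))).sub
    (IsBddFun.const ((X ^ N : ℝ[X]).coeff (N - 1 - (j : ℕ))))
  have e : ∀ x, lcoeff ℝ (N - 1 - (j : ℕ)) (wPoly w x) -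
      (X ^ N : ℝ[X]).coeff (N - 1 - (j : ℕ)) = w j x := fun x => by
    rw [lcoeff_apply, wPoly, coeff_add, add_sub_cancel_left, coeff_lowPoly fun j => w j x]
  simpa only [e] using h1

theorem one_le_wVal (h : IsSpheroEllipsoidal w a ρ) {μ : ℝ} (hμ : ∀ i, a i + 1 ≤ μ) (x : ℝ) :
    1 ≤ wVal w μ x := by
  rw [← eval_wPoly, h.2.2, eval_finsetSum, ← h.2.1 x]
  refine Finset.sum_le_sum fun i _ => ?_
  rw [eval_smul, smul_eq_mul, eval_prod]
  refine le_mul_of_one_le_right (h.1 i x) ?_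
  refine Finset.prod_induction _ (fun y : ℝ => 1 ≤ y) (fun _ _ => one_le_mul_of_one_le_of_one_le)
    le_rfl fun j _ => ?_
  have := hμ j
  simp only [eval_sub, eval_X, eval_C]
  linarith

/-- w(x; z)/∏(z - aᵢ) = ∑ ρᵢ/(z - aᵢ) is a convex combination of numbers whose imaginary parts all
have the sign of -Im z and size at least |Im z|/T. -/
theorem exists_le_normSq_aeval (h : IsSpheroEllipsoidal w a ρ) {z : ℂ} (hz : z.im ≠ 0) :
    ∃ δ > 0, ∀ x, δ ≤ Complex.normSq (aeval z (wPoly w x)) := by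
  have hne : ∀ i, z - a i ≠ 0 := fun i e => hz (by simpa using congrArg Complex.im e)
  have hpos : ∀ i, 0 < Complex.normSq (z - a i) := fun i => Complex.normSq_pos.2 (hne i)
  set T := ∑ i, Complex.normSq (z - a i) with hT
  have hT0 : 0 < T := Finset.sum_pos (fun i _ => hpos i) Finset.univ_nonempty
  have hA : 0 < Complex.normSq (∏ i, (z - a i)) :=
    Complex.normSq_pos.2 (Finset.prod_ne_zero_iff.2 fun i _ => hne i)
  refine ⟨Complex.normSq (∏ i, (z - a i)) * (z.im / T) ^ 2, by positivity, fun x => ?_⟩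
  have e : aeval z (wPoly w x) = (∏ i, (z - a i)) * ∑ i, (ρ i x : ℂ) * (z - a i)⁻¹ := by
    rw [h.2.2, map_sum, Finset.mul_sum]
    refine Finset.sum_congr rfl fun i _ => ?_
    rw [map_smul, map_prod, ← Finset.mul_prod_erase _ _ (Finset.mem_univ i)]
    have := hne i
    simp only [map_sub, aeval_X, aeval_C, Complex.coe_algebraMap, Complex.real_smul]
    field_simp
  rw [e, Complex.normSq_mul]
  refine mul_le_mul_of_nonneg_left ?_ hA.le
  refine le_trans ?_ (Complex.im_sq_le_normSq _)
  have him : (∑ i, (ρ i x : ℂ) * (z - a i)⁻¹).im =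
      -z.im * ∑ i, ρ i x / Complex.normSq (z - a i) := by
    rw [Complex.im_sum, Finset.mul_sum]
    refine Finset.sum_congr rfl fun i _ => ?_
    rw [Complex.im_ofReal_mul, Complex.inv_im]
    simp
    ring
  have hle : 1 / T ≤ ∑ i, ρ i x / Complex.normSq (z - a i) := by
    rw [← h.2.1 x, Finset.sum_div]
    refine Finset.sum_le_sum fun i _ => ?_
    refine div_le_div_of_nonneg_left (h.1 i x) (hpos i) ?_
    exact Finset.single_le_sum (fun j _ => (hpos j).le) (Finset.mem_univ i)
  rw [him, ← pow_two, mul_pow, neg_sq, div_eq_mul_one_div, mul_pow]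
  gcongr

end IsSpheroEllipsoidal

/-! ### Regularity, the third order equation and real roots. -/

namespace IsReducedKdVSolution

variable {N : ℕ} [NeZero N] {P : ℝ[X]} {w : Fin N → ℝ → ℝ}

theorem hasDerivAt (hw : IsReducedKdVSolution P w) (j : Fin N) (x : ℝ) :
    HasDerivAt (w j) (deriv (w j) x) x :=
  ((hw.contDiff j).differentiable (by norm_num) x).hasDerivAt

theorem contDiff_deriv (hw : IsReducedKdVSolution P w) (j : Fin N) : ContDiff ℝ 1 (deriv (w j)) :=
  ((contDiff_succ_iff_deriv (n := 1)).1 (by simpa [one_add_one_eq_two] using hw.contDiff j)).2.2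

theorem hasDerivAt_deriv (hw : IsReducedKdVSolution P w) (j : Fin N) (x : ℝ) :
    HasDerivAt (deriv (w j)) (deriv (deriv (w j)) x) x :=
  ((hw.contDiff_deriv j).differentiable (by norm_num) x).hasDerivAt

theorem hasDerivAt_wVal (hw : IsReducedKdVSolution P w) (μ x : ℝ) :
    HasDerivAt (wVal w μ) ((lowPoly fun j => deriv (w j) x).eval μ) x := by
  have := hasDerivAt_map_wPoly (leval μ) (w := w) (w' := fun j => deriv (w j)) (x := x)
    fun j => hw.hasDerivAt j x
  simpa only [leval_apply, eval_wPoly] using this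

theorem hasDerivAt_deriv_wVal (hw : IsReducedKdVSolution P w) (μ x : ℝ) :
    HasDerivAt (deriv (wVal w μ)) ((lowPoly fun j => deriv (deriv (w j)) x).eval μ) x := by
  have := hasDerivAt_map_lowPoly (leval μ) (w := fun j => deriv (w j))
    (w' := fun j => deriv (deriv (w j))) (x := x) fun j => hw.hasDerivAt_deriv j x
  rw [show deriv (wVal w μ) = fun y => (lowPoly fun j => deriv (w j) y).eval μ from
    funext fun y => (hw.hasDerivAt_wVal μ y).deriv]
  simpa only [leval_apply] using this

theorem polynomial_equation (hw : IsReducedKdVSolution P w) (x : ℝ) :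
    P = (lowPoly fun j => deriv (deriv (w j)) x) * wPoly w x -
      C (1 / 2) * (lowPoly fun j => deriv (w j) x) ^ 2 +
      (X - C (kdvPotential w x)) * wPoly w x ^ 2 := by
  refine Polynomial.funext fun μ => ?_
  rw [hw.equation μ x, (hw.hasDerivAt_wVal μ x).deriv, (hw.hasDerivAt_deriv_wVal μ x).deriv]
  simp [eval_wPoly]

end IsReducedKdVSolution

namespace IsReducedKdVSolution

variable {N : ℕ} [NeZero N] {P : ℝ[X]} {w : Fin N → ℝ → ℝ} {a : Fin (N + 1) → ℝ}
  {ρ : Fin (N + 1) → ℝ → ℝ}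

theorem isBddFun_kdvPotential (h : IsSpheroEllipsoidal w a ρ) : IsBddFun (kdvPotential w) :=
  (h.isBddFun 0).const_mul 2

/-- For large `μ`, `w(·; μ)` is three times continuously differentiable, and its first two
derivatives are bounded. -/
theorem wVal_regularity (hw : IsReducedKdVSolution P w) (h : IsSpheroEllipsoidal w a ρ) {μ : ℝ}
    (hμ : ∀ i, a i + 1 ≤ μ) :
    ContDiff ℝ 3 (wVal w μ) ∧ (IsBddFun fun x => (lowPoly fun j => deriv (w j) x).eval μ) ∧
      IsBddFun fun x => (lowPoly fun j => deriv (deriv (w j)) x).eval μ := by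
  have h0 := hw.hasDerivAt_wVal μ
  have h1 := hw.hasDerivAt_deriv_wVal μ
  have hd0 : deriv (wVal w μ) = fun y => (lowPoly fun j => deriv (w j) y).eval μ :=
    funext fun y => (h0 y).deriv
  have hd1 : deriv (deriv (wVal w μ)) = fun y => (lowPoly fun j => deriv (deriv (w j)) y).eval μ :=
    funext fun y => (h1 y).deriv
  have hone := h.one_le_wVal hμ
  have hne : ∀ x, wVal w μ x ≠ 0 := fun x => (zero_lt_one.trans_le (hone x)).ne'
  have hsec : ∀ x, deriv (deriv (wVal w μ)) x = (P.eval μ + 1 / 2 * deriv (wVal w μ) x ^ 2 -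
      (μ - kdvPotential w x) * wVal w μ x ^ 2) / wVal w μ x := fun x => by
    rw [eq_div_iff (hne x), hw.equation μ x]; ring
  have hu : ContDiff ℝ 1 (kdvPotential w) :=
    contDiff_const.mul ((hw.contDiff 0).of_le (by norm_num))
  have hC1 : ContDiff ℝ 1 (deriv (wVal w μ)) := by
    rw [hd0]
    have : ∀ y, (lowPoly fun j => deriv (w j) y).eval μ =
        ∑ j : Fin N, deriv (w j) y * μ ^ (N - 1 - (j : ℕ)) := fun y => by
      simp [lowPoly, eval_finsetSum]
    simp only [this]
    exact ContDiff.sum fun j _ => (hw.contDiff_deriv j).mul contDiff_const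
  have hdiff0 : Differentiable ℝ (wVal w μ) := fun x => (h0 x).differentiableAt
  have hdiff1 : Differentiable ℝ (deriv (wVal w μ)) := fun x => (h1 x).differentiableAt
  have hC2 : ContDiff ℝ 2 (wVal w μ) := by
    rw [show (2 : WithTop ℕ∞) = 1 + 1 by norm_num, contDiff_succ_iff_deriv]
    exact ⟨hdiff0, by simp, hC1⟩
  have hC3 : ContDiff ℝ 3 (wVal w μ) := by
    rw [show (3 : WithTop ℕ∞) = 1 + 1 + 1 by norm_num, contDiff_succ_iff_deriv]
    refine ⟨hdiff0, by simp, ?_⟩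
    rw [contDiff_succ_iff_deriv]
    refine ⟨hdiff1, by simp, ?_⟩
    rw [funext hsec]
    have hW1 : ContDiff ℝ 1 (wVal w μ) := hC2.of_le (by norm_num)
    exact ((contDiff_const.add (contDiff_const.mul (hC1.pow 2))).sub
      ((contDiff_const.sub hu).mul (hW1.pow 2))).div hW1 hne
  have bW : IsBddFun (wVal w μ) := by
    simpa only [leval_apply, eval_wPoly] using h.isBddFun_map (leval μ)
  have bu := isBddFun_kdvPotential h
  obtain ⟨K, hK⟩ := ((IsBddFun.const μ).sub bu).mul (bW.pow 2)
  have hle : ∀ (x y B : ℝ), 0 ≤ B → -B ≤ y → -B ≤ y / wVal w μ x := fun x y B hB hy => by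
    rw [le_div_iff₀ (zero_lt_one.trans_le (hone x))]
    nlinarith [hone x]
  have hK0 : 0 ≤ K := (abs_nonneg _).trans (hK 0)
  -- The uncontrolled term ½w_x² enters w_xx with a positive sign, so w_xx is bounded below before
  -- w_x is known to be bounded.
  have hlow : ∀ x, -(|P.eval μ| + K) ≤ deriv (deriv (wVal w μ)) x := fun x => by
    rw [hsec]
    refine hle _ _ _ (by positivity) ?_
    have := (abs_le.1 (hK x)).2
    have := neg_abs_le (P.eval μ)
    nlinarith [sq_nonneg (deriv (wVal w μ) x)]
  obtain ⟨M, hM⟩ := bW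
  have b1 : IsBddFun (deriv (wVal w μ)) :=
    ⟨_, abs_deriv_le_of_le_second_deriv (wVal w μ) _ _ (fun x => (hdiff0 x).hasDerivAt)
      (fun x => (hdiff1 x).hasDerivAt) M _ hM hlow (by positivity)⟩
  have b2 : IsBddFun (deriv (deriv (wVal w μ))) := by
    obtain ⟨B, hB⟩ := ((IsBddFun.const (P.eval μ)).add ((b1.pow 2).const_mul (1 / 2))).sub
      (((IsBddFun.const μ).sub bu).mul (IsBddFun.pow ⟨M, hM⟩ 2))
    refine ⟨B, fun x => ?_⟩
    rw [hsec, abs_div, abs_of_pos (zero_lt_one.trans_le (hone x))]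
    exact (div_le_self (abs_nonneg _) (hone x)).trans (hB x)
  rw [hd0] at b1
  rw [hd1] at b2
  exact ⟨hC3, b1, b2⟩

/-- For μ ≥ maxᵢ aᵢ + 1 one has w(x; μ) ≥ 1, so the equation can be solved for w_xx. The
coefficients are recovered linearly from the values at N such points. -/
theorem regularity (hw : IsReducedKdVSolution P w) (h : IsSpheroEllipsoidal w a ρ) (j : Fin N) :
    ContDiff ℝ 3 (w j) ∧ IsBddFun (deriv (w j)) ∧ IsBddFun (deriv (deriv (w j))) := by
  obtain ⟨B, hB⟩ : ∃ B, ∀ i, a i + 1 ≤ B := by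
    obtain ⟨B, hB⟩ := (Set.finite_range fun i => a i + 1).bddAbove
    exact ⟨B, fun i => hB ⟨i, rfl⟩⟩
  let b : Fin N → ℝ := fun m => B + (m : ℕ)
  have hb : Function.Injective b := fun m n e => Fin.ext (by simpa [b] using e)
  have hbB : ∀ m i, a i + 1 ≤ b m := fun m i =>
    (hB i).trans (le_add_of_nonneg_right (Nat.cast_nonneg _))
  obtain ⟨κ, hκ⟩ := exists_coeff_eq_sum_eval N b hb
  refine ⟨?_, ?_, ?_⟩
  · have : w j = fun x => ∑ m, κ j m * (wVal w (b m) x - b m ^ N) := funext fun x => by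
      conv_lhs => rw [hκ (fun j => w j x) j]
      refine Finset.sum_congr rfl fun m _ => ?_
      rw [← eval_wPoly, wPoly, eval_add, eval_pow, eval_X, add_sub_cancel_left]
    rw [this]
    exact ContDiff.sum fun m _ => contDiff_const.mul
      ((hw.wVal_regularity h (hbB m)).1.sub contDiff_const)
  · have : deriv (w j) = fun x => ∑ m, κ j m * (lowPoly fun j => deriv (w j) x).eval (b m) :=
      funext fun x => hκ (fun j => deriv (w j) x) j
    rw [this]
    exact IsBddFun.sum _ fun m _ => (hw.wVal_regularity h (hbB m)).2.1.const_mul _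
  · have : deriv (deriv (w j)) =
        fun x => ∑ m, κ j m * (lowPoly fun j => deriv (deriv (w j)) x).eval (b m) :=
      funext fun x => hκ (fun j => deriv (deriv (w j)) x) j
    rw [this]
    exact IsBddFun.sum _ fun m _ => (hw.wVal_regularity h (hbB m)).2.2.const_mul _

theorem hasDerivAt_deriv_deriv (hw : IsReducedKdVSolution P w) (h : IsSpheroEllipsoidal w a ρ)
    (j : Fin N) (x : ℝ) :
    HasDerivAt (deriv (deriv (w j))) (deriv (deriv (deriv (w j))) x) x := by
  have h1 := (hw.regularity h j).1
  rw [show (3 : WithTop ℕ∞) = 1 + 1 + 1 by norm_num, contDiff_succ_iff_deriv,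
    contDiff_succ_iff_deriv] at h1
  exact (h1.2.2.2.2.differentiable (by norm_num) x).hasDerivAt

theorem hasDerivAt_kdvPotential (hw : IsReducedKdVSolution P w) (x : ℝ) :
    HasDerivAt (kdvPotential w) (2 * deriv (w 0) x) x :=
  (hw.hasDerivAt 0 x).const_mul 2

/-- The third order linear equation `w_xxx + 2 (μ - u) w_x - u_x w = 0`. -/
theorem third_order_equation (hw : IsReducedKdVSolution P w) (h : IsSpheroEllipsoidal w a ρ)
    (x : ℝ) : (lowPoly fun j => deriv (deriv (deriv (w j))) x) =
      C (2 * deriv (w 0) x) * wPoly w x -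
        C 2 * ((X - C (kdvPotential w x)) * lowPoly fun j => deriv (w j) x) := by
  -- Differentiating the constant P in x gives the equation multiplied by w. Cancelling the monic
  -- polynomial w(x; ·) in ℝ[X] works even at values of μ where w(x; μ) vanishes.
  have key : wPoly w x * ((lowPoly fun j => deriv (deriv (deriv (w j))) x) -
      (C (2 * deriv (w 0) x) * wPoly w x -
        C 2 * ((X - C (kdvPotential w x)) * lowPoly fun j => deriv (w j) x))) = 0 := by
    refine Polynomial.funext fun μ => ?_
    have d0 : HasDerivAt (fun y => (wPoly w y).eval μ) _ x :=
      hasDerivAt_map_wPoly (leval μ) fun j => hw.hasDerivAt j x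
    have d1 : HasDerivAt (fun y => (lowPoly fun j => deriv (w j) y).eval μ) _ x :=
      hasDerivAt_map_lowPoly (leval μ) fun j => hw.hasDerivAt_deriv j x
    have d2 : HasDerivAt (fun y => (lowPoly fun j => deriv (deriv (w j)) y).eval μ) _ x :=
      hasDerivAt_map_lowPoly (leval μ) fun j => hw.hasDerivAt_deriv_deriv h j x
    have dP : HasDerivAt (fun y => (lowPoly fun j => deriv (deriv (w j)) y).eval μ *
        (wPoly w y).eval μ - 1 / 2 * (lowPoly fun j => deriv (w j) y).eval μ ^ 2 +
        (μ - kdvPotential w y) * (wPoly w y).eval μ ^ 2) _ x :=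
      ((d2.mul d0).sub ((d1.pow 2).const_mul (1 / 2))).add
        (((hw.hasDerivAt_kdvPotential x).const_sub μ).mul (d0.pow 2))
    have e : (fun y => (lowPoly fun j => deriv (deriv (w j)) y).eval μ *
        (wPoly w y).eval μ - 1 / 2 * (lowPoly fun j => deriv (w j) y).eval μ ^ 2 +
        (μ - kdvPotential w y) * (wPoly w y).eval μ ^ 2) = fun _ => P.eval μ := by
      funext y
      conv_rhs => rw [hw.polynomial_equation y]
      simp
    rw [e] at dP
    have := dP.unique (hasDerivAt_const x _)
    simp only [leval_apply] at this
    push_cast at this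
    simp only [eval_mul, eval_sub, eval_X, eval_C, eval_zero]
    linear_combination this
  exact sub_eq_zero.1 ((mul_eq_zero.1 key).resolve_left (monic_wPoly w x).ne_zero)

/-- All complex roots of the spectral polynomial are real. -/
theorem im_eq_zero_of_aeval_eq_zero (hw : IsReducedKdVSolution P w)
    (h : IsSpheroEllipsoidal w a ρ) (z : ℂ) (hz : aeval z P = 0) : z.im = 0 := by
  by_contra hne
  let φ : ℝ[X] →ₗ[ℝ] ℝ := Complex.reLm ∘ₗ (aeval z).toLinearMap
  let χ : ℝ[X] →ₗ[ℝ] ℝ := Complex.imLm ∘ₗ (aeval z).toLinearMap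
  have hsum : ∀ Q : ℝ[X], (φ Q : ℂ) + χ Q * Complex.I = aeval z Q := fun Q =>
    Complex.re_add_im _
  obtain ⟨δ, hδ, hle⟩ := h.exists_le_normSq_aeval hne
  refine hne (im_eq_zero_of_bounded_complex_solution (kdvPotential w) _ _ _ _ _ _ z.re z.im
    (fun x => hasDerivAt_map_wPoly φ fun j => hw.hasDerivAt j x)
    (fun x => hasDerivAt_map_lowPoly φ fun j => hw.hasDerivAt_deriv j x)
    (fun x => hasDerivAt_map_wPoly χ fun j => hw.hasDerivAt j x)
    (fun x => hasDerivAt_map_lowPoly χ fun j => hw.hasDerivAt_deriv j x)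
    (h.isBddFun_map φ) (isBddFun_map_lowPoly φ fun j => (hw.regularity h j).2.1)
    (h.isBddFun_map χ) (isBddFun_map_lowPoly χ fun j => (hw.regularity h j).2.1)
    δ hδ (fun x => ?_) fun x => ?_)
  · refine (hle x).trans_eq ?_
    rw [Complex.normSq_apply, pow_two, pow_two]; rfl
  · simp only [hsum, Complex.re_add_im]
    rw [← hz]
    conv_rhs => rw [hw.polynomial_equation x]
    simp

end IsReducedKdVSolution

/-! ### The spectrum through Taylor coefficients of the pencil. -/

theorem inSpectrum_half_iff {u : ℝ → ℝ} (hu : Continuous u) (lam : ℝ) :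
    InSpectrum u (lam / 2) ↔ ∃ ψ ψ₁ : ℝ → ℝ, (∀ x, HasDerivAt ψ (ψ₁ x) x) ∧
      (∀ x, HasDerivAt ψ₁ (1 / 2 * (u x - lam) * ψ x) x) ∧ (∃ x, ψ x ≠ 0) ∧ IsBddFun ψ := by
  constructor
  · rintro ⟨ψ, hψ, hne, hbd, heq⟩
    rw [show (2 : WithTop ℕ∞) = 1 + 1 by norm_num, contDiff_succ_iff_deriv] at hψ
    refine ⟨ψ, deriv ψ, fun x => (hψ.1 x).hasDerivAt, fun x => ?_, hne, hbd⟩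
    refine ((hψ.2.2.differentiable (by norm_num) x).hasDerivAt).congr_deriv ?_
    linarith [heq x]
  · rintro ⟨ψ, ψ₁, h0, h1, hne, hbd⟩
    have d0 : deriv ψ = ψ₁ := funext fun x => (h0 x).deriv
    have d1 : deriv ψ₁ = fun x => 1 / 2 * (u x - lam) * ψ x := funext fun x => (h1 x).deriv
    have c0 : Differentiable ℝ ψ := fun x => (h0 x).differentiableAt
    have c1 : Differentiable ℝ ψ₁ := fun x => (h1 x).differentiableAt
    refine ⟨ψ, ?_, hne, hbd, fun x => ?_⟩
    · rw [show (2 : WithTop ℕ∞) = 1 + 1 by norm_num, contDiff_succ_iff_deriv, d0]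
      refine ⟨c0, by simp, contDiff_one_iff_deriv.2 ⟨c1, ?_⟩⟩
      rw [d1]
      exact (continuous_const.mul (hu.sub continuous_const)).mul c0.continuous
    · rw [d0, d1]; ring

/-- The `k`-th Taylor coefficient at `lam`, as a linear functional. -/
noncomputable def taylorCoeff (lam : ℝ) (k : ℕ) : ℝ[X] →ₗ[ℝ] ℝ := lcoeff ℝ k ∘ₗ taylor lam

theorem taylorCoeff_apply (lam : ℝ) (k : ℕ) (Q : ℝ[X]) :
    taylorCoeff lam k Q = (taylor lam Q).coeff k := rfl

theorem taylor_X_sub_C (lam u : ℝ) : taylor lam (X - C u) = X + C (lam - u) := by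
  rw [map_sub, taylor_X, taylor_C, C_sub]; ring

theorem taylorCoeff_zero_X_sub_C_mul (lam u : ℝ) (Q : ℝ[X]) :
    taylorCoeff lam 0 ((X - C u) * Q) = (lam - u) * taylorCoeff lam 0 Q := by
  simp [taylorCoeff_apply, taylor_coeff_zero]

/-- The extra lower coefficient is the source term in the equation of ∂w/∂μ. It disappears for the
first coefficient that is not identically zero. -/
theorem taylorCoeff_succ_X_sub_C_mul (lam u : ℝ) (k : ℕ) (Q : ℝ[X]) :
    taylorCoeff lam (k + 1) ((X - C u) * Q) =
      (lam - u) * taylorCoeff lam (k + 1) Q + taylorCoeff lam k Q := by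
  rw [taylorCoeff_apply, taylor_mul, taylor_X_sub_C, add_mul, coeff_add, coeff_X_mul, coeff_C_mul,
    add_comm]
  rfl

theorem taylorCoeff_C_mul (lam c : ℝ) (k : ℕ) (Q : ℝ[X]) :
    taylorCoeff lam k (C c * Q) = c * taylorCoeff lam k Q := by
  rw [← smul_eq_C_mul, map_smul, smul_eq_mul]

namespace IsReducedKdVSolution

variable {N : ℕ} [NeZero N] {P : ℝ[X]} {w : Fin N → ℝ → ℝ} {a : Fin (N + 1) → ℝ}
  {ρ : Fin (N + 1) → ℝ → ℝ}

theorem continuous_kdvPotential (hw : IsReducedKdVSolution P w) : Continuous (kdvPotential w) :=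
  continuous_const.mul (hw.contDiff 0).continuous

theorem hasDerivAt_half_sub (hw : IsReducedKdVSolution P w) (lam x : ℝ) :
    HasDerivAt (fun y => 1 / 2 * (kdvPotential w y - lam)) (deriv (w 0) x) x := by
  refine (((hw.hasDerivAt_kdvPotential x).sub_const lam).const_mul (1 / 2)).congr_deriv ?_
  ring

theorem isBddFun_half_sub (h : IsSpheroEllipsoidal w a ρ) (lam : ℝ) :
    IsBddFun fun y => 1 / 2 * (kdvPotential w y - lam) :=
  ((isBddFun_kdvPotential h).sub (IsBddFun.const lam)).const_mul _

/-- The Taylor coefficients of orders 0 and 1 at lam play the roles of w and v in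
`eq_zero_of_bounded_of_neg`. -/
theorem not_inSpectrum_of_eval_neg (hw : IsReducedKdVSolution P w)
    (h : IsSpheroEllipsoidal w a ρ) {lam : ℝ} (hP : P.eval lam < 0) :
    ¬ InSpectrum (kdvPotential w) (lam / 2) := by
  rw [inSpectrum_half_iff hw.continuous_kdvPotential]
  rintro ⟨ψ, ψ₁, h0, h1, ⟨x, hx⟩, hb⟩
  have D0 := fun (k : ℕ) (x : ℝ) => hasDerivAt_map_wPoly (taylorCoeff lam k)
    (w' := fun j => deriv (w j)) (x := x) fun j => hw.hasDerivAt j x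
  have D1 := fun (k : ℕ) (x : ℝ) => hasDerivAt_map_lowPoly (taylorCoeff lam k)
    (w' := fun j => deriv (deriv (w j))) (x := x) fun j => hw.hasDerivAt_deriv j x
  have D2 := fun (k : ℕ) (x : ℝ) => hasDerivAt_map_lowPoly (taylorCoeff lam k)
    (w' := fun j => deriv (deriv (deriv (w j)))) (x := x) fun j => hw.hasDerivAt_deriv_deriv h j x
  have B1 := fun k : ℕ => isBddFun_map_lowPoly (taylorCoeff lam k) fun j => (hw.regularity h j).2.1
  have B2 := fun k : ℕ => isBddFun_map_lowPoly (taylorCoeff lam k) fun j => (hw.regularity h j).2.2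
  refine hx (eq_zero_of_bounded_of_neg _ _ (hw.hasDerivAt_half_sub lam) (isBddFun_half_sub h lam)
    _ _ _ _ _ _ (D0 0) (D1 0) (fun x => ?_) (D0 1) (D1 1) (fun x => ?_)
    (h.isBddFun_map _) (B1 0) (B2 0) (h.isBddFun_map _) (B1 1) (B2 1) (P.eval lam) hP
    (fun x => ?_) ψ ψ₁ h0 h1 hb x)
  · refine (D2 0 x).congr_deriv ?_
    rw [hw.third_order_equation h x, map_sub, taylorCoeff_C_mul, taylorCoeff_C_mul,
      taylorCoeff_zero_X_sub_C_mul]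
    ring
  · refine (D2 1 x).congr_deriv ?_
    rw [hw.third_order_equation h x, map_sub, taylorCoeff_C_mul, taylorCoeff_C_mul,
      taylorCoeff_succ_X_sub_C_mul]
    ring
  · conv_rhs => rw [hw.polynomial_equation x]
    simp only [taylorCoeff_apply, taylor_coeff_zero, eval_add, eval_sub, eval_mul, eval_pow,
      eval_C, eval_X]
    ring

theorem inSpectrum_of_nonneg (hw : IsReducedKdVSolution P w)
    (h : IsSpheroEllipsoidal w a ρ) {lam : ℝ} {m : ℕ}
    (hlt : ∀ k < m, ∀ x, taylorCoeff lam k (wPoly w x) = 0) {x₀ : ℝ}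
    (hx₀ : taylorCoeff lam m (wPoly w x₀) ≠ 0) :
    ∃ R : ℝ[X], taylor lam P = X ^ (2 * m) * R ∧
      (0 ≤ R.coeff 0 → InSpectrum (kdvPotential w) (lam / 2)) := by
  have D0 := fun (k : ℕ) (x : ℝ) => hasDerivAt_map_wPoly (taylorCoeff lam k)
    (w' := fun j => deriv (w j)) (x := x) fun j => hw.hasDerivAt j x
  have D1 := fun (k : ℕ) (x : ℝ) => hasDerivAt_map_lowPoly (taylorCoeff lam k)
    (w' := fun j => deriv (deriv (w j))) (x := x) fun j => hw.hasDerivAt_deriv j x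
  have D2 := fun (k : ℕ) (x : ℝ) => hasDerivAt_map_lowPoly (taylorCoeff lam k)
    (w' := fun j => deriv (deriv (deriv (w j)))) (x := x) fun j => hw.hasDerivAt_deriv_deriv h j x
  have z1 : ∀ k < m, ∀ x, taylorCoeff lam k (lowPoly fun j => deriv (w j) x) = 0 := fun k hk x => by
    have := D0 k x
    rw [funext (hlt k hk)] at this
    exact this.unique (hasDerivAt_const x 0)
  have z2 : ∀ k < m, ∀ x, taylorCoeff lam k (lowPoly fun j => deriv (deriv (w j)) x) = 0 :=
    fun k hk x => by
      have := D1 k x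
      rw [funext (z1 k hk)] at this
      exact this.unique (hasDerivAt_const x 0)
  obtain ⟨A, hA⟩ : X ^ m ∣ taylor lam (wPoly w x₀) :=
    X_pow_dvd_iff.2 fun k hk => hlt k hk x₀
  obtain ⟨A₁, hA₁⟩ : X ^ m ∣ taylor lam (lowPoly fun j => deriv (w j) x₀) :=
    X_pow_dvd_iff.2 fun k hk => z1 k hk x₀
  obtain ⟨A₂, hA₂⟩ : X ^ m ∣ taylor lam (lowPoly fun j => deriv (deriv (w j)) x₀) :=
    X_pow_dvd_iff.2 fun k hk => z2 k hk x₀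
  have hc : ∀ (Q B : ℝ[X]), taylor lam Q = X ^ m * B → taylorCoeff lam m Q = B.coeff 0 :=
    fun Q B e => by
      rw [taylorCoeff_apply, e]
      simpa using coeff_X_pow_mul B m 0
  -- Dividing w and its x-derivatives by (μ - lam)^m divides the quadratic expression for P by (μ -
  -- lam)^(2m); R is the quotient, and R(0) is the first integral of the m-th coefficient.
  refine ⟨A₂ * A - C (1 / 2) * A₁ ^ 2 + (X + C (lam - kdvPotential w x₀)) * A ^ 2, ?_, fun hR => ?_⟩
  · rw [hw.polynomial_equation x₀, map_add, map_sub]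
    simp only [taylor_mul, taylor_pow, taylor_C, taylor_X_sub_C, hA, hA₁, hA₂]
    ring
  · obtain ⟨S, hS⟩ := isBddFun_half_sub h lam
    obtain ⟨S', hS'⟩ := (hw.regularity h 0).2.1
    obtain ⟨M, hM⟩ := h.isBddFun_map (taylorCoeff lam m)
    rw [inSpectrum_half_iff hw.continuous_kdvPotential]
    refine exists_bounded_solution_of_nonneg _ _ (hw.hasDerivAt_half_sub lam) S S' hS hS'
      _ _ _ (D0 m) (D1 m) (fun x => ?_) _ hR x₀ ?_ hx₀ M hM
    · refine (D2 m x).congr_deriv ?_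
      rw [hw.third_order_equation h x, map_sub, taylorCoeff_C_mul, taylorCoeff_C_mul]
      cases m with
      | zero => rw [taylorCoeff_zero_X_sub_C_mul]; ring
      | succ m =>
        rw [taylorCoeff_succ_X_sub_C_mul, z1 m (Nat.lt_succ_self m) x]
        ring
    · rw [hc _ _ hA, hc _ _ hA₁, hc _ _ hA₂]
      simp only [coeff_add, coeff_sub, mul_coeff_zero, coeff_C_zero, coeff_X_zero, pow_two]
      ring

theorem inSpectrum_of_eval_nonneg (hw : IsReducedKdVSolution P w)
    (h : IsSpheroEllipsoidal w a ρ) {lam : ℝ} (hd : ¬ IsDegenerateValue P w lam)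
    (hP : 0 ≤ P.eval lam) : InSpectrum (kdvPotential w) (lam / 2) := by
  classical
  have hex : ∃ m, ∃ x, taylorCoeff lam m (wPoly w x) ≠ 0 := by
    -- The Taylor coefficient of top order is the leading coefficient 1, so a first nonvanishing
    -- order exists.
    refine ⟨(wPoly w 0).natDegree, 0, ?_⟩
    rw [taylorCoeff_apply, coeff_taylor_natDegree, (monic_wPoly w 0).leadingCoeff]
    exact one_ne_zero
  obtain ⟨x₀, hx₀⟩ := Nat.find_spec hex
  have hlt : ∀ k < Nat.find hex, ∀ x, taylorCoeff lam k (wPoly w x) = 0 := fun k hk x =>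
    not_not.1 fun hn => Nat.find_min hex hk ⟨x, hn⟩
  generalize Nat.find hex = m at hx₀ hlt
  obtain ⟨R, hR, hspec⟩ := hw.inSpectrum_of_nonneg h hlt hx₀
  refine hspec (not_lt.1 fun hneg => ?_)
  have heval : ∀ μ, P.eval μ = (μ - lam) ^ (2 * m) * R.eval (μ - lam) := fun μ => by
    have := congrArg (eval (μ - lam)) hR
    rwa [taylor_eval, sub_add_cancel, eval_mul, eval_pow, eval_X] at this
  rw [coeff_zero_eq_eval_zero] at hneg
  -- For m = 0, R(0) = P(lam) ≥ 0 contradicts R(0) < 0; for m > 0 the even power leaves P with the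
  -- sign of R near lam.
  rcases Nat.eq_zero_or_pos m with rfl | hm
  · rw [heval] at hP
    simp at hP
    linarith
  · refine hd ⟨fun x => ?_, ?_⟩
    · rw [← eval_wPoly, ← taylor_coeff_zero]
      exact hlt 0 hm x
    · have hcont : Tendsto (fun μ => R.eval (μ - lam)) (𝓝 lam) (𝓝 (R.eval 0)) := by
        have : Continuous fun μ => R.eval (μ - lam) :=
          R.continuous.comp (continuous_id.sub continuous_const)
        simpa using this.tendsto lam
      filter_upwards [(hcont.eventually_lt_const hneg).filter_mono nhdsWithin_le_nhds,
        self_mem_nhdsWithin] with μ h1 h2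
      rw [heval]
      refine mul_neg_of_pos_of_neg ?_ h1
      rw [pow_mul]
      exact pow_pos (sq_pos_of_ne_zero (sub_ne_zero.2 h2)) m

end IsReducedKdVSolution

theorem mainTheorem1 (N : ℕ) [NeZero N] (P : Polynomial ℝ) (w : Fin N → ℝ → ℝ)
    (hw : IsReducedKdVSolution P w) (hNeumann : ComesFromNeumann w) :
    ∃ r : Fin (2 * N + 1) → ℝ, Monotone r ∧
      P = ∏ i, (Polynomial.X - Polynomial.C (r i)) ∧
      bands r = {lam : ℝ | 0 ≤ P.eval lam} ∧
      (∀ lam : ℝ, ¬ IsDegenerateValue P w lam →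
        (InSpectrum (kdvPotential w) (lam / 2) ↔ lam ∈ bands r)) ∧
      ((∀ lam : ℝ, ¬ IsDegenerateValue P w lam) →
        {lam : ℝ | InSpectrum (kdvPotential w) (lam / 2)} = {lam : ℝ | 0 ≤ P.eval lam}) := by
  obtain ⟨a, ρ, h⟩ := hNeumann.exists_isSpheroEllipsoidal
  obtain ⟨r, hr, hPr⟩ := exists_monotone_roots_of_forall_im_eq_zero hw.monic hw.natDegree_eq
    (hw.im_eq_zero_of_aeval_eq_zero h)
  have hbands : bands r = {lam : ℝ | 0 ≤ P.eval lam} := by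
    rw [bands_eq_setOf_nonneg r hr]
    ext lam
    rw [mem_ofPred_eq, mem_ofPred_eq, hPr, eval_prod]
    simp
  have hspec : ∀ lam : ℝ, ¬ IsDegenerateValue P w lam →
      (InSpectrum (kdvPotential w) (lam / 2) ↔ 0 ≤ P.eval lam) := fun lam hd =>
    ⟨fun hs => not_lt.1 fun hneg => hw.not_inSpectrum_of_eval_neg h hneg hs,
      hw.inSpectrum_of_eval_nonneg h hd⟩
  refine ⟨r, hr, hPr, hbands, fun lam hd => ?_, fun hd => Set.ext fun lam => hspec lam (hd lam)⟩
  rw [hbands]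
  exact hspec lam hd
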